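/- Let $n\ge 0$. A Motzkin diagram on $n$ strands is a crossingless partition, into blocks of at most two elements, of $n$ bottom and $n$ top nodes on the two boundary lines of a strip. The Motzkin monoid $\mathcal{M}o_n$ is the set of these diagrams, where $ab$ is obtained by stacking $a$ on top of $b$, gluing the bottom row of $a$ to the top row of $b$, and dropping all components that do not meet the outer rows. A through strand is a block that joins a bottom node to a top node. On a monoid put $a\le_l b\iff \exists c: b=ca$, $a\le_r b\iff\exists c: b=ac$, $a\le_{lr}b\iff\exists c,d: b=cad$. Left cells, right cells and J-cells are the equivalence classes of the relations "$\le$ and $\ge$" for these preorders; J-cells are ordered by $\le_{lr}$; H-cells are the intersections of a left cell and a right cell that lie in the same J-cell. Proposition. All diagrams in a J-cell of $\mathcal{M}o_n$ have the same number of through strands, and the map that sends a J-cell to this number is an order isomorphism from the set of J-cells onto $\{n,n-1,\dots,0\}$ with the reversed order of the integers (so $n$ is the least element). Let $\mathcal{J}_k$ be the J-cell with $k$ through strands, and put $$\ell_{k}=\sum_{t=0}^{n}\frac{k+1}{k+t+1}\binom{n}{k+2t}\binom{k+2t}{t}.$$ Then: 1. $\mathcal{J}_k$ contains exactly $\ell_k$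 left cells and exactly $\ell_k$ right cells. 2. Every left cell $\mathcal{L}\subseteq\mathcal{J}_k$ and every right cell $\mathcal{R}\subseteq\mathcal{J}_k$ has $|\mathcal{L}|=|\mathcal{R}|=\ell_k$ elements, and $|\mathcal{J}_k|=|\mathcal{L}|\cdot|\mathcal{R}|=|\mathcal{L}|^2=\ell_k^2$. 3. $\mathcal{J}_k$ contains an idempotent. 4. Every H-cell $\mathcal{L}\cap\mathcal{R}$ in $\mathcal{J}_k$ has exactly one element, and every H-cell that contains an idempotent is a group under the multiplication of $\mathcal{M}o_n$, isomorphic to the trivial group. -/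

import Mathlib

/-! ### Green's cells of a monoid -/

namespace GreenCell

variable {M : Type*} [Monoid M]

/-- The left order: `a ≤ₗ b` iff `b = c a` for some `c`. -/
def LeftLE (a b : M) : Prop := ∃ c : M, b = c * a

/-- The right order: `a ≤ᵣ b` iff `b = a c` for some `c`. -/
def RightLE (a b : M) : Prop := ∃ c : M, b = a * c

/-- The two-sided order: `a ≤ₗᵣ b` iff `b = c a d` for some `c`, `d`. -/
def TwoSidedLE (a b : M) : Prop := ∃ c d : M, b = c * a * d

/-- Left cells: the equivalence classes of `≤ₗ ∩ ≥ₗ`. -/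
def IsLeftCell (L : Set M) : Prop := ∃ a : M, L = {b | LeftLE a b ∧ LeftLE b a}

/-- Right cells: the equivalence classes of `≤ᵣ ∩ ≥ᵣ`. -/
def IsRightCell (R : Set M) : Prop := ∃ a : M, R = {b | RightLE a b ∧ RightLE b a}

/-- J-cells: the equivalence classes of `≤ₗᵣ ∩ ≥ₗᵣ`. -/
def IsJCell (J : Set M) : Prop := ∃ a : M, J = {b | TwoSidedLE a b ∧ TwoSidedLE b a}

variable (M) in
/-- The type of J-cells of `M`. -/
def JCell : Type _ := {J : Set M // IsJCell J}

/-- The order on J-cells induced by the two-sided order on elements. -/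
instance : LE (JCell M) := ⟨fun J K => ∃ a ∈ J.1, ∃ b ∈ K.1, TwoSidedLE a b⟩

end GreenCell

/-! ### Motzkin diagrams -/

namespace Motzkin

/-- The nodes of a diagram with `n` nodes in each row:
`Sum.inl i` is the `i`-th bottom node and `Sum.inr i` is the `i`-th top node. -/
abbrev Node (n : ℕ) : Type := Fin n ⊕ Fin n

/-- The place of a node on the boundary of the strip, walking along the bottom row from left to
right and then along the top row from right to left. -/
def pos {n : ℕ} : Node n → ℕ
  | Sum.inl i => i
  | Sum.inr i => 2 * n - 1 - i

/-- The nodes of two diagrams stacked on top of each other, with the bottom row of the upper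
diagram identified with the top row of the lower one: bottom, middle and top row. -/
inductive StackNode (n : ℕ) : Type
  | bottom (i : Fin n)
  | middle (i : Fin n)
  | top (i : Fin n)

/-- The nodes of the lower diagram in the stack. -/
def StackNode.lower {n : ℕ} : Node n → StackNode n
  | Sum.inl i => .bottom i
  | Sum.inr i => .middle i

/-- The nodes of the upper diagram in the stack. -/
def StackNode.upper {n : ℕ} : Node n → StackNode n
  | Sum.inl i => .middle i
  | Sum.inr i => .top i

/-- The nodes of the composite in the stack. -/
def StackNode.outer {n : ℕ} : Node n → StackNode n
  | Sum.inl i => .bottom i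
  | Sum.inr i => .top i

/-- Two nodes of the stack are directly linked if they lie in the same block of the upper diagram
or in the same block of the lower diagram. -/
inductive StackLink {n : ℕ} (a b : Setoid (Node n)) : StackNode n → StackNode n → Prop
  | upper {u v : Node n} : a u v → StackLink a b (.upper u) (.upper v)
  | lower {u v : Node n} : b u v → StackLink a b (.lower u) (.lower v)

/-- Composition of partitions, `a` on top of `b`: two outer nodes lie in the same block iff they
are connected in the stack. Components that lie inside the middle row are dropped. -/
def stackRel {n : ℕ} (a b : Setoid (Node n)) : Setoid (Node n) :=
  Setoid.comap StackNode.outer (Relation.EqvGen.setoid (StackLink a b))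

/-- A Motzkin diagram: a crossingless partition of the `n` bottom and `n` top nodes into blocks
of at most two elements. -/
@[ext]
structure Diagram (n : ℕ) where
  rel : Setoid (Node n)
  card_le_two : ∀ x y z : Node n, rel x y → rel x z → x = y ∨ x = z ∨ y = z
  crossingless : ∀ w x y z : Node n, pos w < pos x → pos x < pos y → pos y < pos z →
    rel w y → ¬ rel x z

/-- The number of through strands: blocks that join a bottom node `p.1` to a top node `p.2`. -/
noncomputable def Diagram.throughStrands {n : ℕ} (a : Diagram n) : ℕ :=
  {p : Fin n × Fin n | a.rel (Sum.inl p.1) (Sum.inr p.2)}.ncard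

/-! The composite of two Motzkin diagrams is a Motzkin diagram. The nodes of both diagrams are
placed on a line, so that the glued nodes are nested around position `N`, and are then glued in
pairs, from the innermost pair outwards. -/

/-- Merging the blocks of `p` and `q`. -/
def merge (r : ℕ → ℕ → Prop) (p q x y : ℕ) : Prop :=
  r x y ∨ (r x p ∧ r q y) ∨ (r x q ∧ r p y)

theorem merge_equivalence {r : ℕ → ℕ → Prop} (h : Equivalence r) (p q : ℕ) :
    Equivalence (merge r p q) := by
  obtain ⟨h1, h2, h3⟩ := h
  refine ⟨fun x => Or.inl (h1 x), ?_, ?_⟩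
  · intro x y hxy
    unfold merge at *
    grind
  · intro x y z hxy hyz
    unfold merge at *
    grind

/-- The first `j` glued pairs have been merged. -/
def glue (r : ℕ → ℕ → Prop) (N : ℕ) : ℕ → ℕ → ℕ → Prop
  | 0 => r
  | j + 1 => merge (glue r N j) (N - 1 - j) (N + j)

theorem glue_equivalence {r : ℕ → ℕ → Prop} (h : Equivalence r) (N j : ℕ) :
    Equivalence (glue r N j) := by
  induction j with
  | zero => exact h
  | succ j ih => exact merge_equivalence ih _ _

/-- The relation is a crossingless partial matching on the points outside `[N - j, N + j)`. -/
def IsMotzkinOff (r : ℕ → ℕ → Prop) (N j : ℕ) : Prop :=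
  (∀ x y z, (x + j < N ∨ N + j ≤ x) → (y + j < N ∨ N + j ≤ y) → (z + j < N ∨ N + j ≤ z) →
    r x y → r x z → x = y ∨ x = z ∨ y = z) ∧
  (∀ w x y z, (w + j < N ∨ N + j ≤ w) → (x + j < N ∨ N + j ≤ x) → (y + j < N ∨ N + j ≤ y) →
    (z + j < N ∨ N + j ≤ z) → w < x → x < y → y < z → r w y → ¬ r x z)

theorem isMotzkinOff_merge {r : ℕ → ℕ → Prop} (h : Equivalence r) {N j : ℕ} (hj : j < N)
    (hr : IsMotzkinOff r N j) : IsMotzkinOff (merge r (N - 1 - j) (N + j)) N (j + 1) := by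
  obtain ⟨h1, h2, h3⟩ := h
  obtain ⟨two, cross⟩ := hr
  obtain ⟨p, hp⟩ : ∃ p, p = N - 1 - j := ⟨_, rfl⟩
  obtain ⟨q, hq⟩ : ∃ q, q = N + j := ⟨_, rfl⟩
  obtain ⟨X, hX⟩ : ∃ X : ℕ → Prop, X = fun x => x + j < N ∨ N + j ≤ x := ⟨_, rfl⟩
  have two' : ∀ x y z, X x → X y → X z → r x y → r x z → x = y ∨ x = z ∨ y = z := by
    intro x y z; rw [hX]; exact two x y z
  have cross' : ∀ w x y z, X w → X x → X y → X z → w < x → x < y → y < z → r w y → r x z →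
      False := by
    intro w x y z; rw [hX]; exact cross w x y z
  have hXp : X p := by rw [hX]; dsimp only; omega
  have hXq : X q := by rw [hX]; dsimp only; omega
  have hpq : p < q := by omega
  have key : ∀ x, (x + (j + 1) < N ∨ N + (j + 1) ≤ x) → X x ∧ (x < p ∨ q < x) := by
    intro x hx
    rw [hX]
    dsimp only
    omega
  rw [← hp, ← hq]
  clear hp hq hX two cross
  constructor
  · intro x y z hx hy hz hxy hxz
    obtain ⟨hx, hx'⟩ := key x hx
    obtain ⟨hy, hy'⟩ := key y hy
    obtain ⟨hz, hz'⟩ := key z hz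
    clear key cross'
    unfold merge at *
    rcases hxy with hxy | ⟨hxy, hxy'⟩ | ⟨hxy, hxy'⟩ <;>
      rcases hxz with hxz | ⟨hxz, hxz'⟩ | ⟨hxz, hxz'⟩ <;> grind
  · intro w x y z hw hx hy hz hwx hxy hyz hwy hxz
    obtain ⟨hx, hx'⟩ := key x hx
    obtain ⟨hy, hy'⟩ := key y hy
    obtain ⟨hz, hz'⟩ := key z hz
    obtain ⟨hw, hw'⟩ := key w hw
    clear key
    have c1 := cross' w x y z hw hx hy hz hwx hxy hyz
    -- chords through `p` or `q` cannot cross the chord from `u` to `v`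
    have sep : ∀ u v s t, X u → X v → X s → X t → r u v → u < s → s < v →
        (t < u ∨ v < t) → ¬ r s t := by
      intro u v s t hu hv hs ht huv hus hsv hst hrst
      rcases hst with hst | hst
      · exact cross' t u s v ht hu hs hv hst hus hsv (h2 hrst) huv
      · exact cross' u s v t hu hs hv ht hus hsv hst huv hrst
    have main : ∀ u v s t, X u → X v → X s → X t → r u v → u < s → s < v →
        (t < u ∨ v < t) → (u < p ∨ q < u) → (v < p ∨ q < v) → ¬ (r s p ∧ r t q) ∧
        ¬ (r s q ∧ r t p) := by
      intro u v s t hu hv hs ht huv hus hsv hst hu' hv'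
      have a1 := sep u v s p hu hv hs hXp huv hus hsv
      have a2 := sep u v s q hu hv hs hXq huv hus hsv
      have a3 : u < p → p < v → ¬ r p t := fun h h' => sep u v p t hu hv hXp ht huv h h' hst
      have a4 : u < q → q < v → ¬ r q t := fun h h' => sep u v q t hu hv hXq ht huv h h' hst
      constructor
      · rintro ⟨b1, b2⟩
        have b3 := h2 b2
        by_cases hc : u < p ∧ p < v
        · exact a4 (by omega) (by omega) b3
        · exact a1 (by omega) b1
      · rintro ⟨b1, b2⟩
        have b3 := h2 b2
        by_cases hc : u < p ∧ p < v
        · exact a3 (by omega) (by omega) b3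
        · exact a2 (by omega) b1
    have m1 := main w y x z hw hy hx hz
    have m2 := main x z y w hx hz hy hw
    unfold merge at *
    rcases hwy with hwy | ⟨hwy, hwy'⟩ | ⟨hwy, hwy'⟩
    · have m1 := m1 hwy hwx hxy (Or.inr hyz) hw' hy'
      rcases hxz with hxz | ⟨hxz, hxz'⟩ | ⟨hxz, hxz'⟩
      · exact c1 hwy hxz
      · exact m1.1 ⟨hxz, h2 hxz'⟩
      · exact m1.2 ⟨hxz, h2 hxz'⟩
    all_goals
      rcases hxz with hxz | ⟨hxz, hxz'⟩ | ⟨hxz, hxz'⟩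
      · have m2 := m2 hxz hxy hyz (Or.inl hwx) hx' hz'
        first
        | exact m2.2 ⟨h2 hwy', hwy⟩
        | exact m2.1 ⟨h2 hwy', hwy⟩
      all_goals
        first
        | have := two' p w x hXp hw hx (h2 hwy) (h2 hxz)
          omega
        | have := two' q w x hXq hw hx (h2 hwy) (h2 hxz)
          omega
        | have := two' p w z hXp hw hz (h2 hwy) hxz'
          omega
        | have := two' q w z hXq hw hz (h2 hwy) hxz'
          omega

theorem isMotzkinOff_glue {r : ℕ → ℕ → Prop} (h : Equivalence r) {N : ℕ}
    (hr : IsMotzkinOff r N 0) (j : ℕ) (hj : j ≤ N) : IsMotzkinOff (glue r N j) N j := by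
  induction j with
  | zero => exact hr
  | succ j ih => exact isMotzkinOff_merge (glue_equivalence h N j) hj (ih (by omega))

theorem glue_mono {r : ℕ → ℕ → Prop} {N i j x y : ℕ} (hij : i ≤ j) (h : glue r N i x y) :
    glue r N j x y := by
  induction j, hij using Nat.le_induction with
  | base => exact h
  | succ j _ ih => exact Or.inl ih

theorem glue_pair {r : ℕ → ℕ → Prop} (h : Equivalence r) {N i j : ℕ} (hij : i < j) :
    glue r N j (N - 1 - i) (N + i) :=
  glue_mono (i := i + 1) hij
    (Or.inr (Or.inl ⟨(glue_equivalence h N i).1 _, (glue_equivalence h N i).1 _⟩))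

theorem pos_lt {n : ℕ} (u : Node n) : pos u < 2 * n := by
  rcases u with i | i <;> simp only [pos] <;> omega

theorem pos_injective {n : ℕ} : Function.Injective (pos (n := n)) := by
  rintro (i | i) (j | j) h <;> simp only [pos] at h
  · exact congrArg _ (Fin.ext h)
  · omega
  · omega
  · exact congrArg _ (Fin.ext (by omega))

/-- Both diagrams on a line, the lower one `b` to the left of the upper one `a`. -/
def lineRel {n : ℕ} (a b : Diagram n) (x y : ℕ) : Prop :=
  x = y ∨ (∃ u v, b.rel u v ∧ x = pos u ∧ y = pos v) ∨
    ∃ u v, a.rel u v ∧ x = 2 * n + pos u ∧ y = 2 * n + pos v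

theorem lineRel_equivalence {n : ℕ} (a b : Diagram n) : Equivalence (lineRel a b) := by
  refine ⟨fun x => Or.inl rfl, ?_, ?_⟩
  · rintro x y (h | ⟨u, v, h, hu, hv⟩ | ⟨u, v, h, hu, hv⟩)
    · exact Or.inl h.symm
    · exact Or.inr (Or.inl ⟨v, u, b.rel.symm h, hv, hu⟩)
    · exact Or.inr (Or.inr ⟨v, u, a.rel.symm h, hv, hu⟩)
  · rintro x y z (rfl | ⟨u, v, h, hu, hv⟩ | ⟨u, v, h, hu, hv⟩) h'
    · exact h'
    · rcases h' with rfl | ⟨u', v', h', hu', hv'⟩ | ⟨u', v', h', hu', hv'⟩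
      · exact Or.inr (Or.inl ⟨u, v, h, hu, hv⟩)
      · obtain rfl : v = u' := pos_injective (hv.symm.trans hu')
        exact Or.inr (Or.inl ⟨u, v', b.rel.trans h h', hu, hv'⟩)
      · have := pos_lt v
        omega
    · rcases h' with rfl | ⟨u', v', h', hu', hv'⟩ | ⟨u', v', h', hu', hv'⟩
      · exact Or.inr (Or.inr ⟨u, v, h, hu, hv⟩)
      · have := pos_lt u'
        omega
      · obtain rfl : v = u' := pos_injective (by omega)
        exact Or.inr (Or.inr ⟨u, v', a.rel.trans h h', hu, hv'⟩)

theorem lineRel_isMotzkinOff {n : ℕ} (a b : Diagram n) :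
    IsMotzkinOff (lineRel a b) (2 * n) 0 := by
  constructor
  · rintro x y z - - - (h | ⟨u, v, h, hu, hv⟩ | ⟨u, v, h, hu, hv⟩) h'
    · exact Or.inl h
    · rcases h' with h' | ⟨u', v', h', hu', hv'⟩ | ⟨u', v', h', hu', hv'⟩
      · exact Or.inr (Or.inl h')
      · obtain rfl : u = u' := pos_injective (by omega)
        rcases b.card_le_two u v v' h h' with rfl | rfl | rfl <;> omega
      · have := pos_lt u
        omega
    · rcases h' with h' | ⟨u', v', h', hu', hv'⟩ | ⟨u', v', h', hu', hv'⟩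
      · exact Or.inr (Or.inl h')
      · have := pos_lt u'
        omega
      · obtain rfl : u = u' := pos_injective (by omega)
        rcases a.card_le_two u v v' h h' with rfl | rfl | rfl <;> omega
  · rintro w x y z - - - - hwx hxy hyz (h | ⟨u, v, h, hu, hv⟩ | ⟨u, v, h, hu, hv⟩)
      (h' | ⟨u', v', h', hu', hv'⟩ | ⟨u', v', h', hu', hv'⟩)
    any_goals omega
    · exact b.crossingless u u' v v' (by omega) (by omega) (by omega) h h'
    · have := pos_lt v
      omega
    · have := pos_lt v'
      omega
    · exact a.crossingless u u' v v' (by omega) (by omega) (by omega) h h'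

/-- The place of a node of the stack on the line. -/
def StackNode.linePos {n : ℕ} : StackNode n → ℕ
  | .bottom i => i
  | .middle i => 2 * n + i
  | .top i => 2 * n + (2 * n - 1 - i)

theorem glue_of_stack {n : ℕ} (a b : Diagram n) {x y : StackNode n}
    (h : Relation.EqvGen (StackLink a.rel b.rel) x y) :
    glue (lineRel a b) (2 * n) n x.linePos y.linePos := by
  have e := lineRel_equivalence a b
  have E := glue_equivalence e (2 * n) n
  have low : ∀ u : Node n, glue (lineRel a b) (2 * n) n (StackNode.lower u).linePos (pos u) := by
    rintro (i | i)
    · exact E.1 _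
    · have := glue_pair e (N := 2 * n) (i := i) (j := n) i.2
      exact E.2 this
  have upp : ∀ u : Node n, (StackNode.upper u).linePos = 2 * n + pos u := by
    rintro (i | i) <;> rfl
  induction h with
  | rel x y h =>
    cases h with
    | upper h =>
      rw [upp, upp]
      exact glue_mono (Nat.zero_le _) (Or.inr (Or.inr ⟨_, _, h, rfl, rfl⟩))
    | lower h =>
      exact E.3 (low _) (E.3 (glue_mono (Nat.zero_le _) (Or.inr (Or.inl ⟨_, _, h, rfl, rfl⟩)))
        (E.2 (low _)))
  | refl x => exact E.1 _
  | symm x y _ ih => exact E.2 ih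
  | trans x y z _ _ ih1 ih2 => exact E.3 ih1 ih2

theorem outer_off {n : ℕ} (u : Node n) : (StackNode.outer u).linePos + n < 2 * n ∨
    2 * n + n ≤ (StackNode.outer u).linePos := by
  rcases u with i | i <;> simp only [StackNode.outer, StackNode.linePos] <;> omega

theorem outer_lt {n : ℕ} {u v : Node n} (h : pos u < pos v) :
    (StackNode.outer u).linePos < (StackNode.outer v).linePos := by
  rcases u with i | i <;> rcases v with j | j <;>
    simp only [StackNode.outer, StackNode.linePos, pos] at * <;> omega

theorem outer_injective {n : ℕ} {u v : Node n}
    (h : (StackNode.outer u).linePos = (StackNode.outer v).linePos) : u = v := by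
  apply pos_injective
  rcases lt_trichotomy (pos u) (pos v) with h' | h' | h'
  · have := outer_lt h'
    omega
  · exact h'
  · have := outer_lt h'
    omega

/-- Composition of Motzkin diagrams: `a * b` is `a` stacked on top of `b`, where closed loops and
loose strands in the middle are dropped. -/
instance {n : ℕ} : Mul (Diagram n) where
  mul a b :=
    { rel := stackRel a.rel b.rel
      card_le_two := by
        intro x y z hxy hxz
        have := (isMotzkinOff_glue (lineRel_equivalence a b) (lineRel_isMotzkinOff a b) n
          (by omega)).1 _ _ _ (outer_off x) (outer_off y) (outer_off z)
          (glue_of_stack a b hxy) (glue_of_stack a b hxz)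
        rcases this with h | h | h
        · exact Or.inl (outer_injective h)
        · exact Or.inr (Or.inl (outer_injective h))
        · exact Or.inr (Or.inr (outer_injective h))
      crossingless := by
        intro w x y z hwx hxy hyz hwy hxz
        exact (isMotzkinOff_glue (lineRel_equivalence a b) (lineRel_isMotzkinOff a b) n
          (by omega)).2 _ _ _ _ (outer_off w) (outer_off x) (outer_off y) (outer_off z)
          (outer_lt hwx) (outer_lt hxy) (outer_lt hyz)
          (glue_of_stack a b hwy) (glue_of_stack a b hxz) }

/-- The index of the column of a node. -/
def column {n : ℕ} : Node n → Fin n := Sum.elim id id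

/-- The identity diagram: the `i`-th bottom node is joined to the `i`-th top node. -/
instance {n : ℕ} : One (Diagram n) where
  one :=
    { rel := Setoid.ker column
      card_le_two := by
        rintro (x | x) (y | y) (z | z) h h' <;>
          simp only [Setoid.ker_def, column, Sum.elim_inl, Sum.elim_inr, id] at h h' <;>
          simp [← h, ← h']
      crossingless := by
        rintro (w | w) (x | x) (y | y) (z | z) hwx hxy hyz h h' <;>
          simp only [Setoid.ker_def, column, Sum.elim_inl, Sum.elim_inr, id] at h h' <;>
          simp only [pos] at hwx hxy hyz <;> subst h h' <;> omega }

theorem mul_rel {n : ℕ} (a b : Diagram n) : (a * b).rel = stackRel a.rel b.rel := rfl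

theorem stackRel_iff {n : ℕ} (a b : Setoid (Node n)) (x y : Node n) :
    stackRel a b x y ↔
      Relation.EqvGen (StackLink a b) (StackNode.outer x) (StackNode.outer y) := Iff.rfl

/-- To bound a composite from above it is enough to label the nodes of the stack so that linked
nodes have the same label. -/
theorem label_eq {n : ℕ} {a b : Setoid (Node n)} {β : Type*} (f : StackNode n → β)
    (ha : ∀ u v, a u v → f (.upper u) = f (.upper v))
    (hb : ∀ u v, b u v → f (.lower u) = f (.lower v)) {x y : StackNode n}
    (h : Relation.EqvGen (StackLink a b) x y) : f x = f y := by
  induction h with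
  | rel x y h =>
    cases h with
    | upper h => exact ha _ _ h
    | lower h => exact hb _ _ h
  | refl x => rfl
  | symm x y _ ih => exact ih.symm
  | trans x y z _ _ ih1 ih2 => exact ih1.trans ih2

theorem stack_map {n : ℕ} {a b : Setoid (Node n)} {β : Type*} (f : StackNode n → β)
    (s : Setoid β) (ha : ∀ u v, a u v → s (f (.upper u)) (f (.upper v)))
    (hb : ∀ u v, b u v → s (f (.lower u)) (f (.lower v))) {x y : StackNode n}
    (h : Relation.EqvGen (StackLink a b) x y) : s (f x) (f y) :=
  Quotient.exact (label_eq (fun x => (⟦f x⟧ : Quotient s))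
    (fun u v huv => Quotient.sound (ha u v huv)) (fun u v huv => Quotient.sound (hb u v huv)) h)

theorem one_stackRel {n : ℕ} (b : Setoid (Node n)) :
    stackRel (1 : Diagram n).rel b = b := by
  ext x y
  rw [stackRel_iff]
  have key : ∀ i : Fin n, Relation.EqvGen (StackLink (1 : Diagram n).rel b) (.middle i) (.top i) :=
    fun i => .rel _ _ (.upper (u := Sum.inl i) (v := Sum.inr i) rfl)
  have low : ∀ u : Node n, Relation.EqvGen (StackLink (1 : Diagram n).rel b) (.lower u)
      (.outer u) := by
    rintro (i | i)
    · exact .refl _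
    · exact key i
  let f : StackNode n → Node n
    | .bottom i => Sum.inl i
    | .middle i => Sum.inr i
    | .top i => Sum.inr i
  have fo : ∀ u, f (.outer u) = u := by rintro (i | i) <;> rfl
  constructor
  · intro h
    have := stack_map f b ?_ ?_ h
    · rwa [fo, fo] at this
    · rintro (i | i) (j | j) h <;> obtain rfl : i = j := h <;> exact b.refl _
    · rintro (i | i) (j | j) h <;> exact h
  · intro h
    exact ((low x).symm.trans _ _ _ (.rel _ _ (.lower h))).trans _ _ _ (low y)

theorem stackRel_one {n : ℕ} (a : Setoid (Node n)) :
    stackRel a (1 : Diagram n).rel = a := by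
  ext x y
  rw [stackRel_iff]
  have key : ∀ i : Fin n,
      Relation.EqvGen (StackLink a (1 : Diagram n).rel) (.bottom i) (.middle i) :=
    fun i => .rel _ _ (.lower (u := Sum.inl i) (v := Sum.inr i) rfl)
  have upp : ∀ u : Node n, Relation.EqvGen (StackLink a (1 : Diagram n).rel) (.outer u)
      (.upper u) := by
    rintro (i | i)
    · exact key i
    · exact .refl _
  let f : StackNode n → Node n
    | .bottom i => Sum.inl i
    | .middle i => Sum.inl i
    | .top i => Sum.inr i
  have fo : ∀ u, f (.outer u) = u := by rintro (i | i) <;> rfl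
  constructor
  · intro h
    have := stack_map f a ?_ ?_ h
    · rwa [fo, fo] at this
    · rintro (i | i) (j | j) h <;> exact h
    · rintro (i | i) (j | j) h <;> obtain rfl : i = j := h <;> exact a.refl _
  · intro h
    exact ((upp x).trans _ _ _ (.rel _ _ (.upper h))).trans _ _ _ (upp y).symm

theorem stackRel_assoc_le {n : ℕ} {a b c : Setoid (Node n)} {x y : Node n}
    (h : stackRel (stackRel a b) c x y) : stackRel a (stackRel b c) x y := by
  -- label the rows of the triple stack by classes of the stack of `a` over `b c`
  let bc := Relation.EqvGen.setoid (StackLink b c)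
  let m := Relation.EqvGen.setoid (StackLink a (stackRel b c))
  let g : StackNode n → Set (StackNode n) := fun s => {z | ∃ w, bc (.outer w) s ∧ m (.lower w) z}
  have m_class : ∀ {s t}, m s t → {z | m s z} = {z | m t z} := by
    intro s t hst
    ext z
    exact ⟨fun h => m.trans (m.symm hst) h, fun h => m.trans hst h⟩
  have g_class : ∀ {s t}, bc s t → g s = g t := by
    intro s t hst
    ext z
    exact ⟨fun ⟨w, h1, h2⟩ => ⟨w, bc.trans h1 hst, h2⟩,
      fun ⟨w, h1, h2⟩ => ⟨w, bc.trans h1 (bc.symm hst), h2⟩⟩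
  have g_outer : ∀ w, g (.outer w) = {z | m (.lower w) z} := by
    intro w
    ext z
    constructor
    · rintro ⟨w', h1, h2⟩
      exact m.trans (m.symm (.rel _ _ (.lower h1))) h2
    · intro hz
      exact ⟨w, bc.refl _, hz⟩
  let f : StackNode n → Set (StackNode n)
    | .bottom i => g (.bottom i)
    | .middle i => g (.middle i)
    | .top i => {z | m (.top i) z}
  let k : StackNode n → Set (StackNode n)
    | .bottom i => g (.middle i)
    | .middle i => g (.top i)
    | .top i => {z | m (.top i) z}
  have f_outer : ∀ u, f (.outer u) = {z | m (.outer u) z} := by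
    rintro (i | i)
    · exact g_outer (Sum.inl i)
    · rfl
  have f_lower : ∀ u, f (.lower u) = g (.lower u) := by rintro (i | i) <;> rfl
  have f_upper : ∀ u, f (.upper u) = k (.outer u) := by rintro (i | i) <;> rfl
  have k_lower : ∀ u, k (.lower u) = g (.upper u) := by rintro (i | i) <;> rfl
  have k_upper : ∀ u, k (.upper u) = {z | m (.upper u) z} := by
    rintro (i | i)
    · exact g_outer (Sum.inr i)
    · rfl
  have hf : f (.outer x) = f (.outer y) := by
    refine label_eq f ?_ ?_ h
    · intro u v huv
      rw [f_upper, f_upper]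
      refine label_eq k ?_ ?_ huv
      · intro u v huv
        rw [k_upper, k_upper]
        exact m_class (.rel _ _ (.upper huv))
      · intro u v huv
        rw [k_lower, k_lower]
        exact g_class (.rel _ _ (.upper huv))
    · intro u v huv
      rw [f_lower, f_lower]
      exact g_class (.rel _ _ (.lower huv))
  rw [f_outer, f_outer] at hf
  have hy : StackNode.outer y ∈ {z | m (.outer y) z} := m.refl _
  rw [← hf] at hy
  exact hy

/-- Reflection of a partition in the horizontal axis. -/
def flip {n : ℕ} (a : Setoid (Node n)) : Setoid (Node n) := Setoid.comap Sum.swap a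

theorem flip_iff {n : ℕ} (a : Setoid (Node n)) (x y : Node n) :
    flip a x y ↔ a x.swap y.swap := Iff.rfl

theorem flip_stackRel {n : ℕ} {a b : Setoid (Node n)} {x y : Node n} (h : stackRel a b x y) :
    stackRel (flip b) (flip a) x.swap y.swap := by
  let f : StackNode n → StackNode n
    | .bottom i => .top i
    | .middle i => .middle i
    | .top i => .bottom i
  have f_outer : ∀ u : Node n, f (.outer u) = .outer u.swap := by rintro (i | i) <;> rfl
  have f_upper : ∀ u : Node n, f (.upper u) = .lower u.swap := by rintro (i | i) <;> rfl
  have f_lower : ∀ u : Node n, f (.lower u) = .upper u.swap := by rintro (i | i) <;> rfl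
  rw [stackRel_iff, ← f_outer, ← f_outer]
  refine stack_map f (Relation.EqvGen.setoid _) ?_ ?_ h
  · intro u v huv
    rw [f_upper, f_upper]
    exact .rel _ _ (.lower (by rwa [flip_iff, Sum.swap_swap, Sum.swap_swap]))
  · intro u v huv
    rw [f_lower, f_lower]
    exact .rel _ _ (.upper (by rwa [flip_iff, Sum.swap_swap, Sum.swap_swap]))

theorem flip_flip {n : ℕ} (a : Setoid (Node n)) : flip (flip a) = a := by
  ext x y
  rw [flip_iff, flip_iff, Sum.swap_swap, Sum.swap_swap]

theorem stackRel_flip {n : ℕ} (a b : Setoid (Node n)) :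
    stackRel (flip b) (flip a) = flip (stackRel a b) := by
  ext x y
  constructor
  · intro h
    have := flip_stackRel h
    rwa [flip_flip, flip_flip] at this
  · intro h
    have := flip_stackRel (x := x.swap) (y := y.swap) h
    rwa [Sum.swap_swap, Sum.swap_swap] at this

theorem stackRel_assoc {n : ℕ} (a b c : Setoid (Node n)) :
    stackRel (stackRel a b) c = stackRel a (stackRel b c) := by
  ext x y
  refine ⟨stackRel_assoc_le, fun h => ?_⟩
  have h1 := flip_stackRel h
  rw [← stackRel_flip] at h1
  have h2 := flip_stackRel (stackRel_assoc_le h1)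
  rwa [← stackRel_flip, flip_flip, flip_flip, flip_flip, Sum.swap_swap, Sum.swap_swap] at h2

instance {n : ℕ} : Monoid (Diagram n) where
  mul_assoc a b c := Diagram.ext (stackRel_assoc a.rel b.rel c.rel)
  one_mul a := Diagram.ext (one_stackRel a.rel)
  mul_one a := Diagram.ext (stackRel_one a.rel)

end Motzkin

/-! Cutting a diagram along the middle of the strip leaves two half diagrams, made of arcs, isolated
points and defects where the through strands were cut. The halves have equally many defects, and no
defect lies under an arc. Conversely, two halves with `k` defects each glue to exactly one diagram,
since planarity forces the defects to be joined in increasing order (`exists_diagram_of_halves`,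
`Diagram.eq_of_halves`). Diagrams with `k` through strands are thus pairs of half diagrams with `k`
defects.

Multiplying `a` from above keeps its bottom arcs and can only destroy defects, so the bottom half is
unchanged as soon as no through strand is lost (`Diagram.bottom_mul`). Conversely, any diagram with
the same bottom half is a left multiple of `a` (`exists_mul_eq_of_bottom_eq`). Left cells are
therefore the fibres of the bottom half, right cells by reflection those of the top half, and
J-cells the level sets of the number of through strands. In the resulting grid each H-cell is one
pair of halves, hence a single diagram.

It remains to count half diagrams. The last point is isolated, a defect, or the right end of an arc;
in the last case, cutting the arc turns its left end into the last defect. This gives a three-term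
recursion in `n` and `k` (`IsHalf.cases_last`), which the closed formula satisfies by Pascal's rule
and the recursion of the ballot numbers. -/

namespace Motzkin

/-! ### Half diagrams and reflection -/

/-- A half diagram, given by its arcs `(x, y)` with `x < y` and by the set of its defects, the
points where through strands end. -/
abbrev Half : Type := Set (ℕ × ℕ) × Set ℕ

/-- `h` is a crossingless half diagram on the points `0, …, n - 1` with `k` defects. -/
structure IsHalf (n k : ℕ) (h : Half) : Prop where
  lt : ∀ x y, (x, y) ∈ h.1 → x < y ∧ y < n
  right_unique : ∀ x y z, (x, y) ∈ h.1 → (x, z) ∈ h.1 → y = z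
  left_unique : ∀ x y z, (x, z) ∈ h.1 → (y, z) ∈ h.1 → x = y
  not_chain : ∀ x y z, (x, y) ∈ h.1 → (y, z) ∉ h.1
  crossingless : ∀ w x y z, w < x → x < y → y < z → (w, y) ∈ h.1 → (x, z) ∉ h.1
  defect_lt : ∀ x ∈ h.2, x < n
  defect_left : ∀ x y, x ∈ h.2 → (x, y) ∉ h.1
  defect_right : ∀ x y, x ∈ h.2 → (y, x) ∉ h.1
  defect_outer : ∀ x y z, x ∈ h.2 → y < x → x < z → (y, z) ∉ h.1
  ncard_defects : h.2.ncard = k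

theorem IsHalf.finite_defects {n k : ℕ} {h : Half} (hh : IsHalf n k h) : h.2.Finite :=
  (Set.finite_Iio n).subset hh.defect_lt

theorem pos_swap {n : ℕ} (u : Node n) : pos u.swap = 2 * n - 1 - pos u := by
  rcases u with i | i
  · rfl
  · simp only [pos, Sum.swap_inr]
    omega

/-- Reflection of a diagram in the horizontal axis. -/
def Diagram.flip {n : ℕ} (a : Diagram n) : Diagram n where
  rel := Motzkin.flip a.rel
  card_le_two x y z hxy hxz := by
    have := a.card_le_two _ _ _ hxy hxz
    simpa only [Sum.swap_leftInverse.injective.eq_iff] using this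
  crossingless w x y z hwx hxy hyz hwy hxz := by
    have h1 := pos_lt w
    have h2 := pos_lt x
    have h3 := pos_lt y
    have h4 := pos_lt z
    -- Reflection reverses the order of the nodes along the boundary, so the four nodes are taken
    -- backwards.
    refine a.crossingless z.swap y.swap x.swap w.swap ?_ ?_ ?_ (a.rel.symm hxz)
      (a.rel.symm hwy) <;> simp only [pos_swap] <;> omega

theorem Diagram.flip_flip {n : ℕ} (a : Diagram n) : a.flip.flip = a :=
  Diagram.ext (Motzkin.flip_flip a.rel)

theorem Diagram.flip_mul {n : ℕ} (a b : Diagram n) : (a * b).flip = b.flip * a.flip :=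
  Diagram.ext (stackRel_flip a.rel b.rel).symm

/-! ### The bottom half of a diagram -/

/-- The bottom half of a diagram. -/
def Diagram.bottom {n : ℕ} (a : Diagram n) : Half :=
  ({p | ∃ i j : Fin n, i < j ∧ a.rel (Sum.inl i) (Sum.inl j) ∧ p = ((i : ℕ), (j : ℕ))},
    {x | ∃ i j : Fin n, x = i ∧ a.rel (Sum.inl i) (Sum.inr j)})

theorem Diagram.mem_arcs {n : ℕ} (a : Diagram n) (i j : Fin n) :
    ((i : ℕ), (j : ℕ)) ∈ a.bottom.1 ↔ i < j ∧ a.rel (Sum.inl i) (Sum.inl j) := by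
  constructor
  · rintro ⟨i', j', h, h', e⟩
    obtain ⟨e1, e2⟩ := Prod.mk.inj e
    obtain rfl := Fin.ext e1
    obtain rfl := Fin.ext e2
    exact ⟨h, h'⟩
  · exact fun ⟨h, h'⟩ => ⟨i, j, h, h', rfl⟩

theorem Diagram.mem_defects {n : ℕ} (a : Diagram n) (i : Fin n) :
    (i : ℕ) ∈ a.bottom.2 ↔ ∃ j, a.rel (Sum.inl i) (Sum.inr j) := by
  constructor
  · rintro ⟨i', j, e, h⟩
    obtain rfl := Fin.ext e
    exact ⟨j, h⟩
  · exact fun ⟨j, h⟩ => ⟨i, j, rfl, h⟩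

theorem Diagram.through_unique_right {n : ℕ} (a : Diagram n) {i j j' : Fin n}
    (h : a.rel (Sum.inl i) (Sum.inr j)) (h' : a.rel (Sum.inl i) (Sum.inr j')) : j = j' := by
  simpa using a.card_le_two _ _ _ h h'

theorem Diagram.through_unique_left {n : ℕ} (a : Diagram n) {i i' j : Fin n}
    (h : a.rel (Sum.inl i) (Sum.inr j)) (h' : a.rel (Sum.inl i') (Sum.inr j)) : i = i' := by
  simpa using a.card_le_two _ _ _ (a.rel.symm h) (a.rel.symm h')

theorem Diagram.not_rel_of_through {n : ℕ} (a : Diagram n) {i i' j : Fin n}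
    (h : a.rel (Sum.inl i) (Sum.inr j)) (h' : a.rel (Sum.inl i) (Sum.inl i')) : i = i' := by
  simpa using a.card_le_two _ _ _ h h'

/-- Two through strands in the opposite order would cross, because `pos` runs through the top row
from right to left. -/
theorem Diagram.through_lt {n : ℕ} (a : Diagram n) {i i' j j' : Fin n}
    (h : a.rel (Sum.inl i) (Sum.inr j)) (h' : a.rel (Sum.inl i') (Sum.inr j')) (hi : i < i') :
    j < j' := by
  by_contra hj
  rcases (not_lt.1 hj).lt_or_eq with hj | rfl
  · exact a.crossingless (Sum.inl i) (Sum.inl i') (Sum.inr j) (Sum.inr j') hi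
      (by simp only [pos]; omega) (by simp only [pos]; omega) h h'
  · exact hi.ne (a.through_unique_left h h')

theorem Diagram.ncard_defects {n : ℕ} (a : Diagram n) : a.bottom.2.ncard = a.throughStrands := by
  have : a.bottom.2 = (fun p : Fin n × Fin n => (p.1 : ℕ)) ''
      {p : Fin n × Fin n | a.rel (Sum.inl p.1) (Sum.inr p.2)} := by
    ext x
    constructor
    · rintro ⟨i, j, rfl, h⟩
      exact ⟨(i, j), h, rfl⟩
    · rintro ⟨⟨i, j⟩, h, rfl⟩
      exact ⟨i, j, rfl, h⟩
  rw [this, Set.InjOn.ncard_image]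
  · rfl
  · rintro ⟨i, j⟩ h ⟨i', j'⟩ h' e
    obtain rfl : i = i' := Fin.ext e
    obtain rfl := a.through_unique_right h h'
    rfl

theorem Diagram.throughStrands_flip {n : ℕ} (a : Diagram n) :
    a.flip.throughStrands = a.throughStrands := by
  have : {p : Fin n × Fin n | a.flip.rel (Sum.inl p.1) (Sum.inr p.2)} = Prod.swap ''
      {p : Fin n × Fin n | a.rel (Sum.inl p.1) (Sum.inr p.2)} := by
    rw [Set.image_swap_eq_preimage_swap]
    ext p
    exact ⟨fun h => a.rel.symm h, fun h => a.rel.symm h⟩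
  rw [Diagram.throughStrands, this, Set.ncard_image_of_injective _ Prod.swap_injective]
  rfl

theorem Diagram.isHalf_bottom {n : ℕ} (a : Diagram n) : IsHalf n a.throughStrands a.bottom where
  lt := by
    rintro x y ⟨i, j, h, -, e⟩
    cases e
    exact ⟨h, j.2⟩
  right_unique := by
    rintro x y z ⟨i, j, h, h1, e⟩ ⟨i', j', h', h1', e'⟩
    cases e
    obtain ⟨e1, rfl⟩ := Prod.mk.inj e'
    obtain rfl := Fin.ext e1
    have := a.card_le_two _ _ _ h1 h1'
    simp only [Sum.inl.injEq] at this
    omega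
  left_unique := by
    rintro x y z ⟨i, j, h, h1, e⟩ ⟨i', j', h', h1', e'⟩
    cases e
    obtain ⟨rfl, e1⟩ := Prod.mk.inj e'
    obtain rfl := Fin.ext e1
    have := a.card_le_two _ _ _ (a.rel.symm h1) (a.rel.symm h1')
    simp only [Sum.inl.injEq] at this
    omega
  not_chain := by
    rintro x y z ⟨i, j, h, h1, e⟩ ⟨i', j', h', h1', e'⟩
    cases e
    obtain ⟨e1, rfl⟩ := Prod.mk.inj e'
    obtain rfl := Fin.ext e1
    have := a.card_le_two _ _ _ (a.rel.symm h1) h1'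
    simp only [Sum.inl.injEq] at this
    omega
  crossingless := by
    rintro w x y z hwx hxy hyz ⟨i, j, h, h1, e⟩ ⟨i', j', h', h1', e'⟩
    cases e
    cases e'
    exact a.crossingless (Sum.inl i) (Sum.inl i') (Sum.inl j) (Sum.inl j') hwx hxy hyz h1 h1'
  defect_lt := by
    rintro x ⟨i, j, rfl, -⟩
    exact i.2
  defect_left := by
    rintro x y ⟨i, m, rfl, h⟩ ⟨i', j', h', h1', e'⟩
    obtain ⟨e1, rfl⟩ := Prod.mk.inj e'
    obtain rfl := Fin.ext e1
    exact h'.ne (a.not_rel_of_through h h1')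
  defect_right := by
    rintro x y ⟨i, m, rfl, h⟩ ⟨i', j', h', h1', e'⟩
    obtain ⟨rfl, e1⟩ := Prod.mk.inj e'
    obtain rfl := Fin.ext e1
    exact h'.ne' (a.not_rel_of_through h (a.rel.symm h1'))
  defect_outer := by
    rintro x y z ⟨i, m, rfl, h⟩ h1 h2 ⟨i', j', h', h1', e'⟩
    cases e'
    exact a.crossingless (Sum.inl i') (Sum.inl i) (Sum.inl j') (Sum.inr m) h1 h2
      (by simp only [pos]; omega) h1' h
  ncard_defects := a.ncard_defects

/-! ### The bottom half of a product -/

/-- The block of a bottom node that is not a defect stays in the bottom row, so nothing in the stack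
extends it. The label `f` is membership in this block. -/
theorem Diagram.rel_of_mul_rel {n : ℕ} (c a : Diagram n) {i : Fin n} (hi : (i : ℕ) ∉ a.bottom.2)
    {v : Node n} (h : (c * a).rel (Sum.inl i) v) : ∃ j, v = Sum.inl j ∧
      a.rel (Sum.inl i) (Sum.inl j) := by
  rw [mul_rel, stackRel_iff] at h
  let f : StackNode n → Prop
    | .bottom j => a.rel (Sum.inl i) (Sum.inl j)
    | .middle j => False
    | .top j => False
  have f_lower : ∀ u, f (.lower u) = a.rel (Sum.inl i) u := by
    rintro (j | j)
    · rfl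
    · exact (eq_false fun h => hi ((a.mem_defects i).2 ⟨j, h⟩)).symm
  have f_upper : ∀ u, f (.upper u) = False := by rintro (j | j) <;> rfl
  have := label_eq f (fun u v _ => by rw [f_upper, f_upper])
    (fun u v huv => by
      rw [f_lower, f_lower]
      exact propext ⟨fun h => a.rel.trans h huv, fun h => a.rel.trans h (a.rel.symm huv)⟩) h
  have hv : f (.outer v) := this ▸ a.rel.refl (Sum.inl i)
  rcases v with j | j
  · exact ⟨j, rfl, hv⟩
  · exact hv.elim

theorem Diagram.mul_rel_of_rel {n : ℕ} (c a : Diagram n) {i j : Fin n}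
    (h : a.rel (Sum.inl i) (Sum.inl j)) : (c * a).rel (Sum.inl i) (Sum.inl j) :=
  .rel _ _ (.lower (u := Sum.inl i) (v := Sum.inl j) h)

theorem Diagram.defects_mul_subset {n : ℕ} (c a : Diagram n) :
    (c * a).bottom.2 ⊆ a.bottom.2 := by
  rintro x ⟨i, j, rfl, h⟩
  by_contra hi
  obtain ⟨m, hm, -⟩ := c.rel_of_mul_rel a hi h
  cases hm

theorem Diagram.throughStrands_mul_le_right {n : ℕ} (c a : Diagram n) :
    (c * a).throughStrands ≤ a.throughStrands := by
  rw [← Diagram.ncard_defects, ← Diagram.ncard_defects]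
  exact Set.ncard_le_ncard (c.defects_mul_subset a) a.isHalf_bottom.finite_defects

theorem Diagram.throughStrands_mul_le_left {n : ℕ} (a c : Diagram n) :
    (a * c).throughStrands ≤ a.throughStrands := by
  rw [← a.throughStrands_flip, ← (a * c).throughStrands_flip, Diagram.flip_mul]
  exact Diagram.throughStrands_mul_le_right _ _

/-- Defects can only be lost, so the inequality forces the defect sets to agree. An end of an arc of
the product is then not a defect of `a`, and the arc was already present in `a`. -/
theorem Diagram.bottom_mul {n : ℕ} (c a : Diagram n)
    (h : a.throughStrands ≤ (c * a).throughStrands) : (c * a).bottom = a.bottom := by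
  have hD : (c * a).bottom.2 = a.bottom.2 := by
    refine Set.eq_of_subset_of_ncard_le (c.defects_mul_subset a) ?_
      a.isHalf_bottom.finite_defects
    rwa [Diagram.ncard_defects, Diagram.ncard_defects]
  refine Prod.ext (Set.Subset.antisymm ?_ ?_) hD
  · rintro p ⟨i, j, hij, hr, rfl⟩
    have hi : (i : ℕ) ∉ a.bottom.2 := by
      intro hi
      rw [← hD, Diagram.mem_defects] at hi
      obtain ⟨m, hm⟩ := hi
      exact hij.ne ((c * a).not_rel_of_through hm hr)
    obtain ⟨m, hm, hr'⟩ := c.rel_of_mul_rel a hi hr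
    cases hm
    exact ⟨i, j, hij, hr', rfl⟩
  · rintro p ⟨i, j, hij, hr, rfl⟩
    exact ⟨i, j, hij, c.mul_rel_of_rel a hr, rfl⟩

/-! ### Diagrams as pairs of half diagrams -/

theorem Diagram.rel_inl_iff {n : ℕ} (a : Diagram n) (i j : Fin n) :
    a.rel (Sum.inl i) (Sum.inl j) ↔
      i = j ∨ ((i : ℕ), (j : ℕ)) ∈ a.bottom.1 ∨ ((j : ℕ), (i : ℕ)) ∈ a.bottom.1 := by
  rw [Diagram.mem_arcs, Diagram.mem_arcs]
  constructor
  · intro h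
    rcases lt_trichotomy i j with hij | hij | hij
    · exact Or.inr (Or.inl ⟨hij, h⟩)
    · exact Or.inl hij
    · exact Or.inr (Or.inr ⟨hij, a.rel.symm h⟩)
  · rintro (rfl | h | h)
    · exact a.rel.refl _
    · exact h.2
    · exact a.rel.symm h.2

/-- There is only one increasing bijection between two finite sets of integers. In the induction, if
the strands of `a` and `b` at `i` end at different places, the smaller end is reached in the other
diagram from some `i' < i`, where both diagrams already agree. -/
theorem Diagram.through_of_defects_eq {n : ℕ} {a b : Diagram n} (h : a.bottom.2 = b.bottom.2)
    (h' : a.flip.bottom.2 = b.flip.bottom.2) (i : Fin n) :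
    ∀ j, a.rel (Sum.inl i) (Sum.inr j) → b.rel (Sum.inl i) (Sum.inr j) := by
  induction i using WellFoundedLT.induction with
  | ind i ih =>
    intro j hij
    obtain ⟨j', hj'⟩ := (b.mem_defects i).1 (h ▸ (a.mem_defects i).2 ⟨j, hij⟩)
    rcases lt_trichotomy j j' with hj | rfl | hj
    · obtain ⟨i', hi'⟩ := (b.flip.mem_defects j).1
        (h' ▸ (a.flip.mem_defects j).2 ⟨i, a.rel.symm hij⟩)
      replace hi' : b.rel (Sum.inl i') (Sum.inr j) := b.rel.symm hi'
      have hlt : i' < i := by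
        by_contra hc
        rcases (not_lt.1 hc).lt_or_eq with hc | rfl
        · exact absurd (b.through_lt hj' hi' hc) (by omega)
        · exact hj.ne (b.through_unique_right hi' hj')
      obtain ⟨m, hm⟩ := (a.mem_defects i').1 (h ▸ (b.mem_defects i').2 ⟨j, hi'⟩)
      obtain rfl := b.through_unique_right (ih i' hlt m hm) hi'
      exact absurd (a.through_unique_left hm hij) hlt.ne
    · exact hj'
    · obtain ⟨i', hi'⟩ := (a.flip.mem_defects j').1
        (h' ▸ (b.flip.mem_defects j').2 ⟨i, b.rel.symm hj'⟩)
      replace hi' : a.rel (Sum.inl i') (Sum.inr j') := a.rel.symm hi'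
      have hlt : i' < i := by
        by_contra hc
        rcases (not_lt.1 hc).lt_or_eq with hc | rfl
        · exact absurd (a.through_lt hij hi' hc) (by omega)
        · exact hj.ne (a.through_unique_right hi' hij)
      exact absurd (b.through_unique_left (ih i' hlt j' hi') hj') hlt.ne

/-- A diagram is determined by its bottom half and its top half. -/
theorem Diagram.eq_of_halves {n : ℕ} {a b : Diagram n} (h : a.bottom = b.bottom)
    (h' : a.flip.bottom = b.flip.bottom) : a = b := by
  have hth : ∀ i j, a.rel (Sum.inl i) (Sum.inr j) ↔ b.rel (Sum.inl i) (Sum.inr j) :=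
    fun i j => ⟨through_of_defects_eq (congrArg Prod.snd h) (congrArg Prod.snd h') i j,
      through_of_defects_eq (congrArg Prod.snd h).symm (congrArg Prod.snd h').symm i j⟩
  refine Diagram.ext (Setoid.ext ?_)
  rintro (i | i) (j | j)
  · rw [Diagram.rel_inl_iff, Diagram.rel_inl_iff, h]
  · exact hth i j
  · rw [Setoid.comm', hth, Setoid.comm']
  · have := a.flip.rel_inl_iff i j
    rw [h', ← b.flip.rel_inl_iff i j] at this
    exact this

/-- The last clause also makes `R` single-valued and injective: two related pairs that share one
coordinate must share the other. -/
theorem exists_monotone_matching {s t : Set ℕ} (hs : s.Finite) (ht : t.Finite)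
    (h : s.ncard = t.ncard) : ∃ R : ℕ → ℕ → Prop, (∀ i j, R i j → i ∈ s ∧ j ∈ t) ∧
      (∀ i ∈ s, ∃ j, R i j) ∧ (∀ j ∈ t, ∃ i, R i j) ∧
      ∀ i j i' j', R i j → R i' j' → (i < i' ↔ j < j') := by
  obtain ⟨s, rfl⟩ := hs.exists_finset_coe
  obtain ⟨t, rfl⟩ := ht.exists_finset_coe
  rw [Set.ncard_coe_finset, Set.ncard_coe_finset] at h
  let e : s ≃o t := (s.orderIsoOfFin rfl).symm.trans (t.orderIsoOfFin h.symm)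
  refine ⟨fun i j => ∃ x : s, i = x ∧ j = e x, ?_, ?_, ?_, ?_⟩
  · rintro i j ⟨x, rfl, rfl⟩
    exact ⟨x.2, (e x).2⟩
  · exact fun i hi => ⟨e ⟨i, hi⟩, ⟨i, hi⟩, rfl, rfl⟩
  · exact fun j hj => ⟨e.symm ⟨j, hj⟩, e.symm ⟨j, hj⟩, rfl, by simp⟩
  · rintro i j i' j' ⟨x, rfl, rfl⟩ ⟨x', rfl, rfl⟩
    exact (e.lt_iff_lt (x := x) (y := x')).symm

/-- Gluing two half diagrams along a matching of their defects. -/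
def glueRel {n : ℕ} (h h' : Half) (R : ℕ → ℕ → Prop) : Node n → Node n → Prop
  | Sum.inl i, Sum.inl j => (i : ℕ) = j ∨ ((i : ℕ), (j : ℕ)) ∈ h.1 ∨ ((j : ℕ), (i : ℕ)) ∈ h.1
  | Sum.inr i, Sum.inr j => (i : ℕ) = j ∨ ((i : ℕ), (j : ℕ)) ∈ h'.1 ∨ ((j : ℕ), (i : ℕ)) ∈ h'.1
  | Sum.inl i, Sum.inr j => R i j
  | Sum.inr i, Sum.inl j => R j i

/-- Through strands do not cross each other because the matching is increasing, and do not cross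
arcs because no defect lies under an arc. -/
theorem exists_diagram_of_halves {n k : ℕ} {h h' : Half} (hh : IsHalf n k h)
    (hh' : IsHalf n k h') : ∃ a : Diagram n, a.bottom = h ∧ a.flip.bottom = h' := by
  obtain ⟨R, R1, R2, R3, R4⟩ := exists_monotone_matching hh.finite_defects hh'.finite_defects
    (hh.ncard_defects.trans hh'.ncard_defects.symm)
  obtain ⟨a1, a2, a3, a4, a5, a6, a7, a8, a9, -⟩ := hh
  obtain ⟨b1, b2, b3, b4, b5, b6, b7, b8, b9, -⟩ := hh'
  have R5 : ∀ i j j', R i j → R i j' → j = j' := by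
    intro i j j' h1 h2
    have := R4 _ _ _ _ h1 h2
    have := R4 _ _ _ _ h2 h1
    omega
  have R6 : ∀ i i' j, R i j → R i' j → i = i' := by
    intro i j j' h1 h2
    have := R4 _ _ _ _ h1 h2
    have := R4 _ _ _ _ h2 h1
    omega
  have eqv : Equivalence (glueRel (n := n) h h' R) := by
    refine ⟨?_, ?_, ?_⟩
    · rintro (i | i) <;> exact Or.inl rfl
    · rintro (i | i) (j | j) hij <;> simp only [glueRel] at * <;> grind
    · rintro (i | i) (j | j) (m | m) hij hjm <;> simp only [glueRel] at * <;> grind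
  refine ⟨⟨⟨glueRel h h' R, eqv⟩, ?_, ?_⟩, ?_, ?_⟩
  · rintro (i | i) (j | j) (m | m) hij hjm <;> change glueRel h h' R _ _ at hij <;>
      change glueRel h h' R _ _ at hjm <;>
      simp only [glueRel, Sum.inl.injEq, Sum.inr.injEq, reduceCtorEq, Fin.ext_iff] at * <;> grind
  -- Bottom nodes precede top nodes in `pos`, so only five of the sixteen row patterns survive
  -- `omega`: those with zero to four top nodes, in this order. Arcs of the top row appear with
  -- their ends reversed.
  · rintro (w | w) (x | x) (y | y) (z | z) hwx hxy hyz hwy hxz <;>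
      change glueRel h h' R _ _ at hwy <;> change glueRel h h' R _ _ at hxz <;>
      simp only [pos, glueRel] at * <;> first | omega | skip
    · grind
    · have := R1 _ _ hxz
      grind
    · have := R4 _ _ _ _ hwy hxz
      omega
    · have hy := (R1 _ _ hwy).2
      replace hxz := hxz.resolve_left (by omega)
      rcases hxz with hxz | hxz
      · exact absurd (b1 _ _ hxz).1 (by omega)
      · exact b9 _ _ _ hy (by omega) (by omega) hxz
    · replace hwy := hwy.resolve_left (by omega)
      replace hxz := hxz.resolve_left (by omega)
      rcases hwy with hwy | hwy
      · exact absurd (b1 _ _ hwy).1 (by omega)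
      rcases hxz with hxz | hxz
      · exact absurd (b1 _ _ hxz).1 (by omega)
      exact b5 _ _ _ _ (by omega) (by omega) (by omega) hxz hwy
  · refine Prod.ext (Set.ext ?_) (Set.ext ?_)
    · rintro ⟨x, y⟩
      constructor
      · rintro ⟨i, j, hij, hr, e⟩
        cases e
        change glueRel h h' R _ _ at hr
        simp only [glueRel] at hr
        grind
      · intro hxy
        have := a1 _ _ hxy
        exact ⟨⟨x, by omega⟩, ⟨y, by omega⟩, this.1, Or.inr (Or.inl hxy), rfl⟩
    · intro x
      constructor
      · rintro ⟨i, j, rfl, hr⟩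
        exact (R1 _ _ hr).1
      · intro hx
        obtain ⟨j, hj⟩ := R2 x hx
        exact ⟨⟨x, a6 x hx⟩, ⟨j, b6 j (R1 _ _ hj).2⟩, rfl, hj⟩
  · refine Prod.ext (Set.ext ?_) (Set.ext ?_)
    · rintro ⟨x, y⟩
      constructor
      · rintro ⟨i, j, hij, hr, e⟩
        cases e
        change glueRel h h' R (Sum.inr _) (Sum.inr _) at hr
        simp only [glueRel] at hr
        grind
      · intro hxy
        have := b1 _ _ hxy
        exact ⟨⟨x, by omega⟩, ⟨y, by omega⟩, this.1, Or.inr (Or.inl hxy), rfl⟩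
    · intro x
      constructor
      · rintro ⟨i, j, rfl, hr⟩
        exact (R1 _ _ hr).2
      · intro hx
        obtain ⟨j, hj⟩ := R3 x hx
        exact ⟨⟨x, b6 x hx⟩, ⟨j, a6 j (R1 _ _ hj).1⟩, rfl, hj⟩

/-! ### Ballot numbers and the recursion of the closed formula -/

/-- The number of ballot sequences with `t` down-steps that end at height `k`. -/
def ballot (k t : ℕ) : ℚ := ((k : ℚ) + 1) / ((k : ℚ) + (t : ℚ) + 1) * ((k + 2 * t).choose t : ℚ)

theorem ballot_zero (k : ℕ) : ballot k 0 = 1 := by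
  have : (k : ℚ) + 1 ≠ 0 := by positivity
  simp [ballot, this]

/-- The difference form known from the reflection principle; in it the recursions below reduce to
Pascal's rule. -/
theorem ballot_succ (k t : ℕ) :
    ballot k (t + 1) = (k + 2 * t + 2).choose (t + 1) - (k + 2 * t + 2).choose t := by
  have h := Nat.choose_succ_right_eq (k + 2 * t + 2) t
  rw [show k + 2 * t + 2 - t = k + t + 2 by omega] at h
  have h' : ((k + 2 * t + 2).choose (t + 1) : ℚ) * (t + 1) =
      (k + 2 * t + 2).choose t * (k + t + 2) := by exact_mod_cast h
  have hk : (k : ℚ) + (t + 1) + 1 ≠ 0 := by positivity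
  rw [ballot, show k + 2 * (t + 1) = k + 2 * t + 2 by ring]
  push_cast
  field_simp
  linear_combination -h'

/-- The last step of a nonempty ballot sequence that ends at height 0 goes down from height 1. The
computation needs, besides Pascal's rule, the symmetry of the two middle binomial coefficients. -/
theorem ballot_zero_succ (t : ℕ) : ballot 0 (t + 1) = ballot 1 t := by
  rw [ballot_succ]
  cases t with
  | zero => rw [ballot_zero]; norm_num [Nat.choose]
  | succ t =>
    rw [ballot_succ, show 0 + 2 * (t + 1) + 2 = (1 + 2 * t + 2) + 1 by ring,
      Nat.choose_succ_succ' (1 + 2 * t + 2) (t + 1), Nat.choose_succ_succ' (1 + 2 * t + 2) t]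
    have := Nat.choose_symm_of_eq_add (n := 1 + 2 * t + 2) (a := t + 1 + 1) (b := t + 1) (by ring)
    rw [this]
    push_cast
    ring

/-- The last step goes up from height `k` or down from height `k + 2`. -/
theorem ballot_succ_succ (k t : ℕ) :
    ballot (k + 1) (t + 1) = ballot k (t + 1) + ballot (k + 2) t := by
  rw [ballot_succ, ballot_succ]
  cases t with
  | zero =>
    rw [ballot_zero]
    simp
    ring
  | succ t =>
    rw [ballot_succ, show k + 1 + 2 * (t + 1) + 2 = (k + 2 * t + 4) + 1 by ring,
      show k + 2 * (t + 1) + 2 = k + 2 * t + 4 by ring,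
      show k + 2 + 2 * t + 2 = k + 2 * t + 4 by ring,
      Nat.choose_succ_succ' (k + 2 * t + 4) (t + 1), Nat.choose_succ_succ' (k + 2 * t + 4) t]
    push_cast
    ring

/-- The number of half diagrams on `n` points with `k` defects. -/
def halfCount (n k : ℕ) : ℚ :=
  ∑ t ∈ Finset.range (n + 1), (n.choose (k + 2 * t) : ℚ) * ballot k t

/-- The extra terms vanish. Lengthening the range lets sums for different `n` and `k` be compared
term by term. -/
theorem halfCount_eq_sum {n N : ℕ} (hN : n < N) (k : ℕ) :
    halfCount n k = ∑ t ∈ Finset.range N, (n.choose (k + 2 * t) : ℚ) * ballot k t := by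
  refine Finset.sum_subset (Finset.range_subset_range.2 hN) ?_
  intro t _ ht
  rw [Finset.mem_range] at ht
  rw [Nat.choose_eq_zero_of_lt (by omega)]
  simp

theorem halfCount_zero_zero : halfCount 0 0 = 1 := by
  simp [halfCount, ballot_zero]

theorem halfCount_zero_succ (k : ℕ) : halfCount 0 (k + 1) = 0 := by
  simp [halfCount]

theorem halfCount_succ_zero (n : ℕ) : halfCount (n + 1) 0 = halfCount n 0 + halfCount n 1 := by
  -- The sum for one more defect is taken one term shorter: its index `t` is matched with `t + 1` in
  -- the other sums, whose terms at 0 are split off.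
  rw [halfCount_eq_sum (show n + 1 < n + 2 + 1 by omega) 0,
    halfCount_eq_sum (show n < n + 2 + 1 by omega) 0, halfCount_eq_sum (show n < n + 2 by omega) 1,
    Finset.sum_range_succ', Finset.sum_range_succ' _ (n + 2), add_right_comm (Finset.sum _ _),
    ← Finset.sum_add_distrib]
  congr 1
  · refine Finset.sum_congr rfl fun t _ => ?_
    rw [ballot_zero_succ, show 0 + 2 * (t + 1) = (1 + 2 * t) + 1 by ring,
      Nat.choose_succ_succ' n]
    push_cast
    ring
  · simp

/-- Pascal's rule decides whether the last point is isolated; if it is not, `ballot_succ_succ`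
splits according to the last step. -/
theorem halfCount_succ_succ (n k : ℕ) : halfCount (n + 1) (k + 1) =
    halfCount n (k + 1) + halfCount n k + halfCount n (k + 2) := by
  rw [halfCount_eq_sum (show n + 1 < n + 2 + 1 by omega) (k + 1),
    halfCount_eq_sum (show n < n + 2 + 1 by omega) (k + 1),
    halfCount_eq_sum (show n < n + 2 + 1 by omega) k,
    halfCount_eq_sum (show n < n + 2 by omega) (k + 2), ← Finset.sum_add_distrib,
    Finset.sum_range_succ', Finset.sum_range_succ' _ (n + 2), add_right_comm (Finset.sum _ _),
    ← Finset.sum_add_distrib]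
  congr 1
  · refine Finset.sum_congr rfl fun t _ => ?_
    rw [ballot_succ_succ, show k + 1 + 2 * (t + 1) = (k + 2 * (t + 1)) + 1 by ring,
      show k + 2 + 2 * t = k + 2 * (t + 1) by ring, Nat.choose_succ_succ' n]
    push_cast
    ring
  · simp only [ballot_zero, mul_zero, add_zero, Nat.choose_succ_succ' n k]
    push_cast
    ring

/-! ### Counting half diagrams by their last point -/

/-- Adding the point `n` as a defect. -/
def Half.addDefect (n : ℕ) (h : Half) : Half := (h.1, insert n h.2)

/-- Adding the point `n` and joining it to the last defect. -/
noncomputable def Half.addArc (n : ℕ) (h : Half) : Half :=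
  (insert (sSup h.2, n) h.1, h.2 \ {sSup h.2})

theorem IsHalf.succ {n k : ℕ} {h : Half} (hh : IsHalf n k h) : IsHalf (n + 1) k h := by
  obtain ⟨a1, a2, a3, a4, a5, a6, a7, a8, a9, a10⟩ := hh
  exact ⟨by grind, a2, a3, a4, a5, by grind, a7, a8, a9, a10⟩

theorem IsHalf.addDefect {n k : ℕ} {h : Half} (hh : IsHalf n k h) :
    IsHalf (n + 1) (k + 1) (h.addDefect n) := by
  have hf := hh.finite_defects
  obtain ⟨a1, a2, a3, a4, a5, a6, a7, a8, a9, a10⟩ := hh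
  refine ⟨?_, a2, a3, a4, a5, ?_, ?_, ?_, ?_, ?_⟩ <;> simp only [Half.addDefect]
  any_goals grind
  rw [Set.ncard_insert_of_notMem (fun h => (a6 _ h).ne rfl) hf, a10]

/-- Having `k + 1` defects makes `sSup h.2` a genuine last defect. The new arc covers no defect
because it starts at the last one, and crosses no arc because no arc passes over a defect. -/
theorem IsHalf.addArc {n k : ℕ} {h : Half} (hh : IsHalf n (k + 1) h) :
    IsHalf (n + 1) k (h.addArc n) := by
  have hf := hh.finite_defects
  have hne : h.2.Nonempty := Set.nonempty_of_ncard_ne_zero (by rw [hh.ncard_defects]; omega)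
  have hm : sSup h.2 ∈ h.2 := Nat.sSup_mem hne hf.bddAbove
  have hle : ∀ x ∈ h.2, x ≤ sSup h.2 := fun x hx => le_csSup hf.bddAbove hx
  unfold Half.addArc
  generalize sSup h.2 = m at *
  obtain ⟨a1, a2, a3, a4, a5, a6, a7, a8, a9, a10⟩ := hh
  refine ⟨?_, ?_, ?_, ?_, ?_, ?_, ?_, ?_, ?_, ?_⟩ <;>
    simp only [Set.mem_insert_iff, Prod.mk.injEq, Set.mem_sdiff, Set.mem_singleton_iff]
  any_goals grind
  rw [Set.ncard_sdiff_singleton_of_mem hm, a10, Nat.add_sub_cancel]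

theorem addDefect_injOn (n k : ℕ) : Set.InjOn (Half.addDefect n) {h | IsHalf n k h} := by
  intro h hh h' hh' e
  obtain ⟨e1, e2⟩ := Prod.mk.inj e
  refine Prod.ext e1 (Set.ext fun x => ?_)
  have := Set.ext_iff.1 e2 x
  have h1 := hh.defect_lt x
  have h2 := hh'.defect_lt x
  grind

/-- The partner of the point `n` reveals which defect was used. -/
theorem addArc_injOn (n k : ℕ) : Set.InjOn (Half.addArc n) {h | IsHalf n (k + 1) h} := by
  intro h hh h' hh' e
  have mem : ∀ {h}, IsHalf n (k + 1) h → sSup h.2 ∈ h.2 := fun hh => Nat.sSup_mem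
    (Set.nonempty_of_ncard_ne_zero (by rw [hh.ncard_defects]; omega)) hh.finite_defects.bddAbove
  have hm := mem hh
  have hm' := mem hh'
  obtain ⟨e1, e2⟩ := Prod.mk.inj e
  have h1 := hh.lt
  have h2 := hh'.lt
  generalize sSup h.2 = m at *
  generalize sSup h'.2 = m' at *
  have hmm : m = m' := by
    have := (Set.ext_iff.1 e1 (m, n)).1 (Set.mem_insert _ _)
    grind
  subst hmm
  refine Prod.ext (Set.ext ?_) (Set.ext fun x => ?_)
  · rintro ⟨x, y⟩
    have := Set.ext_iff.1 e1 (x, y)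
    grind
  · have := Set.ext_iff.1 e2 x
    grind

theorem IsHalf.cases_last {n k : ℕ} {h : Half} (hh : IsHalf (n + 1) k h) :
    IsHalf n k h ∨ (∃ j g, k = j + 1 ∧ IsHalf n j g ∧ h = g.addDefect n) ∨
      ∃ g, IsHalf n (k + 1) g ∧ h = g.addArc n := by
  have hf := hh.finite_defects
  obtain ⟨a1, a2, a3, a4, a5, a6, a7, a8, a9, a10⟩ := hh
  by_cases hn : n ∈ h.2
  · right; left
    have hk := Set.ncard_sdiff_singleton_add_one hn hf
    refine ⟨(h.2 \ {n}).ncard, (h.1, h.2 \ {n}), by omega,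
      ⟨?_, a2, a3, a4, a5, ?_, ?_, ?_, ?_, rfl⟩, ?_⟩
    any_goals grind
    · rw [Half.addDefect, Set.insert_sdiff_singleton, Set.insert_eq_of_mem hn]
  by_cases hi : ∃ i, (i, n) ∈ h.1
  · right; right
    obtain ⟨i, hi⟩ := hi
    -- A defect to the right of `i` would lie under the arc `(i, n)`. Once the arc is cut, `i` is
    -- therefore the last defect, and `Half.addArc` restores the arc.
    have hsup : sSup (insert i h.2) = i := by
      refine IsGreatest.csSup_eq ⟨Set.mem_insert _ _, ?_⟩
      rintro x (rfl | hx)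
      · exact le_rfl
      · by_contra hc
        have := a6 x hx
        have : x ≠ n := fun e => hn (e ▸ hx)
        exact a9 x i n hx (by omega) (by omega) hi
    refine ⟨(h.1 \ {(i, n)}, insert i h.2), ⟨?_, ?_, ?_, ?_, ?_, ?_, ?_, ?_, ?_, ?_⟩, ?_⟩
    any_goals
      simp only [Set.mem_insert_iff, Prod.mk.injEq, Set.mem_sdiff, Set.mem_singleton_iff]
      grind
    · rw [Set.ncard_insert_of_notMem (fun hc => a7 _ _ hc hi) hf, a10]
    · rw [Half.addArc, hsup, Set.insert_sdiff_singleton, Set.insert_eq_of_mem hi]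
      refine Prod.ext rfl ?_
      simp only [Set.insert_sdiff_of_mem, Set.mem_singleton_iff]
      rw [Set.sdiff_singleton_eq_self (fun hc => a7 _ _ hc hi)]
  · left
    exact ⟨by grind, a2, a3, a4, a5, by grind, a7, a8, a9, a10⟩

theorem setOf_isHalf_succ_zero (n : ℕ) : {h | IsHalf (n + 1) 0 h} =
    {h | IsHalf n 0 h} ∪ Half.addArc n '' {h | IsHalf n 1 h} := by
  ext h
  constructor
  · intro hh
    rcases IsHalf.cases_last hh with h1 | ⟨j, g, hj, -⟩ | ⟨g, hg, rfl⟩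
    · exact Or.inl h1
    · omega
    · exact Or.inr ⟨g, hg, rfl⟩
  · rintro (hh | ⟨g, hg, rfl⟩)
    · exact IsHalf.succ hh
    · exact IsHalf.addArc hg

theorem setOf_isHalf_succ_succ (n k : ℕ) : {h | IsHalf (n + 1) (k + 1) h} =
    {h | IsHalf n (k + 1) h} ∪ Half.addDefect n '' {h | IsHalf n k h} ∪
      Half.addArc n '' {h | IsHalf n (k + 2) h} := by
  ext h
  constructor
  · intro hh
    rcases IsHalf.cases_last hh with h1 | ⟨j, g, hj, hg, rfl⟩ | ⟨g, hg, rfl⟩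
    · exact Or.inl (Or.inl h1)
    · obtain rfl : k = j := by omega
      exact Or.inl (Or.inr ⟨g, hg, rfl⟩)
    · exact Or.inr ⟨g, hg, rfl⟩
  · rintro ((hh | ⟨g, hg, rfl⟩) | ⟨g, hg, rfl⟩)
    · exact IsHalf.succ hh
    · exact IsHalf.addDefect hg
    · exact IsHalf.addArc hg

theorem disjoint_addArc (n k j : ℕ) :
    Disjoint {h | IsHalf n k h} (Half.addArc n '' {h | IsHalf n j h}) := by
  rw [Set.disjoint_left]
  rintro - hh ⟨g, hg, rfl⟩
  exact (hh.lt _ _ (Set.mem_insert _ _)).2.ne rfl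

theorem disjoint_addDefect (n k j : ℕ) :
    Disjoint {h | IsHalf n k h} (Half.addDefect n '' {h | IsHalf n j h}) := by
  rw [Set.disjoint_left]
  rintro - hh ⟨g, hg, rfl⟩
  exact (hh.defect_lt _ (Set.mem_insert _ _)).ne rfl

theorem disjoint_addDefect_addArc (n k j : ℕ) :
    Disjoint (Half.addDefect n '' {h | IsHalf n k h}) (Half.addArc n '' {h | IsHalf n j h}) := by
  rw [Set.disjoint_left]
  rintro - ⟨g, hg, rfl⟩ ⟨g', hg', e⟩
  have h1 : (sSup g'.2, n) ∈ (g.addDefect n).1 := e ▸ Set.mem_insert _ _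
  exact (hg.lt _ _ h1).2.ne rfl

theorem setOf_isHalf_zero_zero : {h | IsHalf 0 0 h} = {((∅, ∅) : Half)} := by
  ext h
  constructor
  · intro hh
    refine Prod.ext (Set.eq_empty_of_forall_notMem ?_) (Set.eq_empty_of_forall_notMem ?_)
    · rintro ⟨x, y⟩ hxy
      exact absurd (hh.lt x y hxy).2 (by omega)
    · exact fun x hx => absurd (hh.defect_lt x hx) (by omega)
  · rintro rfl
    constructor <;> simp

theorem setOf_isHalf_zero_succ (k : ℕ) : {h | IsHalf 0 (k + 1) h} = ∅ := by
  refine Set.eq_empty_of_forall_notMem fun h hh => ?_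
  obtain ⟨x, hx⟩ := Set.nonempty_of_ncard_ne_zero (s := h.2) (by rw [hh.ncard_defects]; omega)
  exact absurd (hh.defect_lt x hx) (by omega)

/-- Finiteness is needed to add the `ncard` of the disjoint pieces. -/
theorem finite_setOf_isHalf (n : ℕ) : ∀ k, {h | IsHalf n k h}.Finite := by
  induction n with
  | zero =>
    rintro (_ | k)
    · rw [setOf_isHalf_zero_zero]
      exact Set.finite_singleton _
    · rw [setOf_isHalf_zero_succ]
      exact Set.finite_empty
  | succ n ih =>
    rintro (_ | k)
    · rw [setOf_isHalf_succ_zero]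
      exact (ih _).union ((ih _).image _)
    · rw [setOf_isHalf_succ_succ]
      exact ((ih _).union ((ih _).image _)).union ((ih _).image _)

theorem ncard_setOf_isHalf (n : ℕ) : ∀ k, ({h | IsHalf n k h}.ncard : ℚ) = halfCount n k := by
  induction n with
  | zero =>
    rintro (_ | k)
    · rw [setOf_isHalf_zero_zero, Set.ncard_singleton, halfCount_zero_zero, Nat.cast_one]
    · rw [setOf_isHalf_zero_succ, Set.ncard_empty, halfCount_zero_succ, Nat.cast_zero]
  | succ n ih =>
    have fin := finite_setOf_isHalf n
    rintro (_ | k)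
    · rw [setOf_isHalf_succ_zero, halfCount_succ_zero, ← ih, ← ih,
        Set.ncard_union_eq (disjoint_addArc _ _ _) (fin _) ((fin _).image _),
        (addArc_injOn n 0).ncard_image, Nat.cast_add]
    · rw [setOf_isHalf_succ_succ, halfCount_succ_succ, ← ih, ← ih, ← ih,
        Set.ncard_union_eq (Set.disjoint_union_left.2
          ⟨disjoint_addArc _ _ _, disjoint_addDefect_addArc _ _ _⟩)
          ((fin _).union ((fin _).image _)) ((fin _).image _),
        Set.ncard_union_eq (disjoint_addDefect _ _ _) (fin _) ((fin _).image _),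
        (addArc_injOn n (k + 1)).ncard_image,
        (addDefect_injOn n k).ncard_image, Nat.cast_add, Nat.cast_add]

/-! ### Left, right and two-sided cells -/

open GreenCell

theorem Diagram.throughStrands_eq_of_bottom_eq {n : ℕ} {a b : Diagram n}
    (h : a.bottom = b.bottom) : a.throughStrands = b.throughStrands := by
  rw [← a.ncard_defects, ← b.ncard_defects, h]

theorem exists_mul_eq_of_bottom_eq {n : ℕ} {a b : Diagram n} (h : b.bottom = a.bottom) :
    ∃ c, b = c * a := by
  have hT := Diagram.throughStrands_eq_of_bottom_eq h
  have ha := a.flip.isHalf_bottom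
  have hb := b.flip.isHalf_bottom
  rw [Diagram.throughStrands_flip] at ha hb
  rw [hT] at hb
  -- The multiplier `c` has the top half of `a` as its bottom and the top half of `b` as its top.
  -- Every through strand of `a` then continues through `c`, so none is lost and `c * a` has the
  -- halves of `b`.
  obtain ⟨c, hc, hc'⟩ := exists_diagram_of_halves ha hb
  have hcT : c.throughStrands = a.throughStrands :=
    (Diagram.throughStrands_eq_of_bottom_eq hc).trans a.throughStrands_flip
  have hsub : a.bottom.2 ⊆ (c * a).bottom.2 := by
    rintro x ⟨i, m, rfl, him⟩
    have hm : (m : ℕ) ∈ c.bottom.2 := by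
      rw [hc]
      exact ⟨m, i, rfl, a.rel.symm him⟩
    obtain ⟨j, hj⟩ := (c.mem_defects m).1 hm
    exact ⟨i, j, rfl, .trans _ _ _ (.rel _ _ (.lower him)) (.rel _ _ (.upper hj))⟩
  have hle : a.throughStrands ≤ (c * a).throughStrands := by
    rw [← a.ncard_defects, ← (c * a).ncard_defects]
    exact Set.ncard_le_ncard hsub (c * a).isHalf_bottom.finite_defects
  refine ⟨c, Diagram.eq_of_halves (h.trans (c.bottom_mul a hle).symm) ?_⟩
  rw [Diagram.flip_mul, Diagram.bottom_mul _ _ _, hc']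
  rwa [← Diagram.flip_mul, Diagram.throughStrands_flip, Diagram.throughStrands_flip, hcT]

/-- If `a` and `c * a` are left multiples of each other, they have equally many through strands, so
`Diagram.bottom_mul` applies. -/
theorem leftCell_eq {n : ℕ} (a : Diagram n) :
    {b | LeftLE a b ∧ LeftLE b a} = {b | b.bottom = a.bottom} := by
  ext b
  constructor
  · rintro ⟨⟨c, rfl⟩, ⟨d, hd⟩⟩
    refine Diagram.bottom_mul _ _ ?_
    have := Diagram.throughStrands_mul_le_right d (c * a)
    rwa [← hd] at this
  · intro h
    exact ⟨exists_mul_eq_of_bottom_eq h, exists_mul_eq_of_bottom_eq h.symm⟩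

theorem rightLE_iff_leftLE_flip {n : ℕ} (a b : Diagram n) :
    RightLE a b ↔ LeftLE a.flip b.flip := by
  constructor
  · rintro ⟨c, rfl⟩
    exact ⟨c.flip, Diagram.flip_mul a c⟩
  · rintro ⟨c, hc⟩
    refine ⟨c.flip, ?_⟩
    rw [← b.flip_flip, hc, Diagram.flip_mul, Diagram.flip_flip]

theorem rightCell_eq {n : ℕ} (a : Diagram n) :
    {b | RightLE a b ∧ RightLE b a} = {b | b.flip.bottom = a.flip.bottom} := by
  ext b
  simp only [rightLE_iff_leftLE_flip]
  exact Set.ext_iff.1 (leftCell_eq a.flip) b.flip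

theorem twoSidedLE_of_throughStrands_eq {n : ℕ} {a b : Diagram n}
    (h : a.throughStrands = b.throughStrands) : TwoSidedLE a b := by
  have ha := a.isHalf_bottom
  have hb := b.flip.isHalf_bottom
  rw [Diagram.throughStrands_flip, ← h] at hb
  -- The diagram `x` with the bottom of `a` and the top of `b` lies in the left cell of `a` and in
  -- the right cell of `b`.
  obtain ⟨x, hx, hx'⟩ := exists_diagram_of_halves ha hb
  obtain ⟨c, hc⟩ := exists_mul_eq_of_bottom_eq hx
  obtain ⟨d, hd⟩ := (rightLE_iff_leftLE_flip x b).2 (exists_mul_eq_of_bottom_eq hx'.symm)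
  exact ⟨c, d, by rw [hd, hc]⟩

/-- The diagram whose first `k` columns are through strands and whose other nodes are isolated. -/
def proj (n k : ℕ) : Diagram n where
  rel :=
    { r := fun u v => u = v ∨ (column u = column v ∧ (column u : ℕ) < k)
      iseqv := ⟨fun _ => Or.inl rfl, by grind, by grind⟩ }
  card_le_two := by
    rintro (x | x) (y | y) (z | z) (h | ⟨h, -⟩) (h' | ⟨h', -⟩) <;>
      simp only [column, Sum.elim_inl, Sum.elim_inr, id, Sum.inl.injEq, Sum.inr.injEq,
        reduceCtorEq] at h h' <;> simp [← h, ← h']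
  crossingless := by
    rintro w x y z hwx hxy hyz (h | ⟨h, -⟩) (h' | ⟨h', -⟩)
    · exact absurd (hwx.trans hxy) (h ▸ lt_irrefl _)
    · exact absurd (hwx.trans hxy) (h ▸ lt_irrefl _)
    · exact absurd (hxy.trans hyz) (h' ▸ lt_irrefl _)
    · revert w x y z
      rintro (w | w) (x | x) (y | y) (z | z) hwx hxy hyz h h' <;>
        simp only [column, Sum.elim_inl, Sum.elim_inr, id] at h h' <;>
        simp only [pos] at hwx hxy hyz <;> subst h h' <;> omega

theorem throughStrands_proj {n k : ℕ} (hk : k ≤ n) : (proj n k).throughStrands = k := by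
  have : (proj n k).bottom.2 = Set.Iio k := by
    ext x
    constructor
    · rintro ⟨i, j, rfl, h | ⟨-, h⟩⟩
      · cases h
      · exact h
    · intro hx
      have hx' : x < n := lt_of_lt_of_le hx hk
      exact ⟨⟨x, hx'⟩, ⟨x, hx'⟩, rfl, Or.inr ⟨rfl, hx⟩⟩
  rw [← Diagram.ncard_defects, this, Set.ncard_eq_toFinset_card']
  simp

/-- For `j = k` this provides the idempotents; for `j < k` it makes J-cells with different numbers
of through strands comparable. -/
theorem proj_mul_proj {n j k : ℕ} (hjk : j ≤ k) : proj n j * proj n k = proj n j := by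
  refine Diagram.ext (Setoid.ext fun x y => ?_)
  rw [mul_rel, stackRel_iff]
  constructor
  -- Collapsing the lower diagram onto its columns is harmless, because all its blocks lie in single
  -- columns; what remains is the upper diagram.
  · let f : StackNode n → Node n
      | .bottom i => Sum.inl i
      | .middle i => Sum.inl i
      | .top i => Sum.inr i
    have f_outer : ∀ u, f (.outer u) = u := by rintro (i | i) <;> rfl
    have f_upper : ∀ u, f (.upper u) = u := by rintro (i | i) <;> rfl
    have f_lower : ∀ u, f (.lower u) = Sum.inl (column u) := by rintro (i | i) <;> rfl
    intro h
    have := stack_map f (proj n j).rel ?_ ?_ h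
    · rwa [f_outer, f_outer] at this
    · intro u v huv
      rwa [f_upper, f_upper]
    · intro u v huv
      have : column u = column v := by
        rcases huv with rfl | huv
        · rfl
        · exact huv.1
      rw [f_lower, f_lower, this]
  · rintro (rfl | ⟨h, hj⟩)
    · exact .refl _
    · have key : ∀ u : Node n, (column u : ℕ) < j → Relation.EqvGen
          (StackLink (proj n j).rel (proj n k).rel) (.outer u) (.middle (column u)) := by
        rintro (i | i) hi
        · exact .rel _ _ (.lower (u := Sum.inl i) (v := Sum.inr i) (Or.inr ⟨rfl, hi.trans_le hjk⟩))
        · exact .rel _ _ (.upper (u := Sum.inr i) (v := Sum.inl i) (Or.inr ⟨rfl, hi⟩))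
      exact (key x hj).trans _ _ _ (h ▸ (key y (h ▸ hj)).symm)

theorem Diagram.throughStrands_le {n : ℕ} (a : Diagram n) : a.throughStrands ≤ n := by
  rw [← a.ncard_defects]
  have h : a.bottom.2 ⊆ Set.Iio n := a.isHalf_bottom.defect_lt
  refine (Set.ncard_le_ncard h (Set.finite_Iio n)).trans ?_
  rw [Set.ncard_eq_toFinset_card']
  simp

theorem twoSidedLE_iff {n : ℕ} (a b : Diagram n) :
    TwoSidedLE a b ↔ b.throughStrands ≤ a.throughStrands := by
  constructor
  · rintro ⟨c, d, rfl⟩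
    exact (Diagram.throughStrands_mul_le_left _ _).trans (Diagram.throughStrands_mul_le_right _ _)
  · intro h
    obtain ⟨c, d, hcd⟩ := twoSidedLE_of_throughStrands_eq
      (throughStrands_proj a.throughStrands_le).symm
    obtain ⟨c', d', hcd'⟩ := twoSidedLE_of_throughStrands_eq
      (throughStrands_proj b.throughStrands_le)
    -- The passage goes from `a` to its projection, down to the projection of `b`, and on to `b`.
    refine ⟨c' * proj n b.throughStrands * c, d * d', ?_⟩
    calc b = c' * (proj n b.throughStrands * proj n a.throughStrands) * d' := by
          rw [proj_mul_proj h, ← hcd']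
      _ = c' * proj n b.throughStrands * c * a * (d * d') := by
          rw [hcd]
          simp only [mul_assoc]

theorem isJCell_iff {n : ℕ} (J : Set (Diagram n)) :
    IsJCell J ↔ ∃ k ≤ n, J = {b | b.throughStrands = k} := by
  have key : ∀ a : Diagram n, {b | TwoSidedLE a b ∧ TwoSidedLE b a} =
      {b | b.throughStrands = a.throughStrands} := by
    intro a
    ext b
    simp only [twoSidedLE_iff, Set.mem_ofPred_eq]
    exact le_antisymm_iff.symm
  constructor
  · rintro ⟨a, rfl⟩
    exact ⟨a.throughStrands, a.throughStrands_le, key a⟩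
  · rintro ⟨k, hk, rfl⟩
    exact ⟨proj n k, by rw [key, throughStrands_proj hk]⟩

/-- The order isomorphism that sends a J-cell to its number of through strands. -/
noncomputable def jCellOrderIso (n : ℕ) : JCell (Diagram n) ≃o (Fin (n + 1))ᵒᵈ where
  toFun J := OrderDual.toDual ⟨((isJCell_iff J.1).1 J.2).choose,
    Nat.lt_succ_of_le ((isJCell_iff J.1).1 J.2).choose_spec.1⟩
  invFun k := ⟨{b | b.throughStrands = (OrderDual.ofDual k : Fin (n + 1))},
    (isJCell_iff _).2 ⟨_, Nat.le_of_lt_succ (OrderDual.ofDual k).2, rfl⟩⟩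
  left_inv J := Subtype.ext ((isJCell_iff J.1).1 J.2).choose_spec.2.symm
  right_inv k := by
    have hk := Nat.le_of_lt_succ (OrderDual.ofDual k).2
    have hJ := (isJCell_iff
      {b : Diagram n | b.throughStrands = (OrderDual.ofDual k : Fin (n + 1))}).1
      ((isJCell_iff _).2 ⟨_, hk, rfl⟩)
    have : proj n (OrderDual.ofDual k : Fin (n + 1)) ∈
        {b : Diagram n | b.throughStrands = hJ.choose} := by
      rw [← hJ.choose_spec.2]
      exact throughStrands_proj hk
    exact OrderDual.ofDual.injective (Fin.ext <| this.symm.trans (throughStrands_proj hk))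
  map_rel_iff' := by
    intro J K
    have hJ := ((isJCell_iff J.1).1 J.2).choose_spec
    have hK := ((isJCell_iff K.1).1 K.2).choose_spec
    change ((isJCell_iff K.1).1 K.2).choose ≤ ((isJCell_iff J.1).1 J.2).choose ↔
      ∃ a ∈ J.1, ∃ b ∈ K.1, TwoSidedLE a b
    generalize ((isJCell_iff J.1).1 J.2).choose = j at *
    generalize ((isJCell_iff K.1).1 K.2).choose = k at *
    rw [hJ.2, hK.2]
    constructor
    · intro h
      refine ⟨proj n j, throughStrands_proj hJ.1, proj n k, throughStrands_proj hK.1, ?_⟩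
      rwa [twoSidedLE_iff, throughStrands_proj hJ.1, throughStrands_proj hK.1]
    · rintro ⟨a, rfl, b, rfl, h⟩
      exact (twoSidedLE_iff a b).1 h

theorem jCellOrderIso_eq {n : ℕ} (J : JCell (Diagram n)) {a : Diagram n} (ha : a ∈ J.1) :
    ((OrderDual.ofDual (jCellOrderIso n J) : Fin (n + 1)) : ℕ) = a.throughStrands := by
  rw [((isJCell_iff J.1).1 J.2).choose_spec.2] at ha
  exact ha.symm

/-! ### Numbers and sizes of cells -/

theorem isHalf_bottom_iff {n k : ℕ} (a : Diagram n) :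
    IsHalf n k a.bottom ↔ a.throughStrands = k := by
  constructor
  · exact fun h => a.ncard_defects.symm.trans h.ncard_defects
  · rintro rfl
    exact a.isHalf_bottom

theorem isHalf_flip_bottom_iff {n k : ℕ} (a : Diagram n) :
    IsHalf n k a.flip.bottom ↔ a.throughStrands = k := by
  rw [isHalf_bottom_iff, Diagram.throughStrands_flip]

theorem isLeftCell_subset_iff {n k : ℕ} (L : Set (Diagram n)) :
    IsLeftCell L ∧ L ⊆ {b | b.throughStrands = k} ↔
      ∃ h, IsHalf n k h ∧ {b : Diagram n | b.bottom = h} = L := by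
  constructor
  · rintro ⟨⟨a, rfl⟩, hL⟩
    rw [leftCell_eq] at hL ⊢
    exact ⟨a.bottom, (isHalf_bottom_iff a).2 (hL rfl), rfl⟩
  · rintro ⟨h, hh, rfl⟩
    -- Gluing `h` to its own mirror image shows that the fibre over `h` is not empty, so it is the
    -- left cell of some diagram.
    obtain ⟨a, rfl, -⟩ := exists_diagram_of_halves hh hh
    refine ⟨⟨a, (leftCell_eq a).symm⟩, fun b hb => (isHalf_bottom_iff b).1 ?_⟩
    rwa [show b.bottom = a.bottom from hb]

theorem isRightCell_subset_iff {n k : ℕ} (R : Set (Diagram n)) :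
    IsRightCell R ∧ R ⊆ {b | b.throughStrands = k} ↔
      ∃ h, IsHalf n k h ∧ {b : Diagram n | b.flip.bottom = h} = R := by
  constructor
  · rintro ⟨⟨a, rfl⟩, hR⟩
    rw [rightCell_eq] at hR ⊢
    exact ⟨a.flip.bottom, (isHalf_flip_bottom_iff a).2 (hR rfl), rfl⟩
  · rintro ⟨h, hh, rfl⟩
    obtain ⟨a, -, rfl⟩ := exists_diagram_of_halves hh hh
    refine ⟨⟨a, (rightCell_eq a).symm⟩, fun b hb => (isHalf_flip_bottom_iff b).1 ?_⟩
    rwa [show b.flip.bottom = a.flip.bottom from hb]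

theorem ncard_leftCells (n k : ℕ) :
    {L : Set (Diagram n) | IsLeftCell L ∧ L ⊆ {b | b.throughStrands = k}}.ncard =
      {h | IsHalf n k h}.ncard := by
  have : {L : Set (Diagram n) | IsLeftCell L ∧ L ⊆ {b | b.throughStrands = k}} =
      (fun h => {b : Diagram n | b.bottom = h}) '' {h | IsHalf n k h} :=
    Set.ext fun L => isLeftCell_subset_iff L
  rw [this, Set.InjOn.ncard_image]
  intro h hh h' _ e
  obtain ⟨a, ha, -⟩ := exists_diagram_of_halves hh hh
  have : a ∈ {b : Diagram n | b.bottom = h'} := (Set.ext_iff.1 e a).1 ha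
  exact ha.symm.trans this

theorem ncard_rightCells (n k : ℕ) :
    {R : Set (Diagram n) | IsRightCell R ∧ R ⊆ {b | b.throughStrands = k}}.ncard =
      {h | IsHalf n k h}.ncard := by
  have : {R : Set (Diagram n) | IsRightCell R ∧ R ⊆ {b | b.throughStrands = k}} =
      (fun h => {b : Diagram n | b.flip.bottom = h}) '' {h | IsHalf n k h} :=
    Set.ext fun R => isRightCell_subset_iff R
  rw [this, Set.InjOn.ncard_image]
  intro h hh h' _ e
  obtain ⟨a, -, ha⟩ := exists_diagram_of_halves hh hh
  have : a ∈ {b : Diagram n | b.flip.bottom = h'} := (Set.ext_iff.1 e a).1 ha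
  exact ha.symm.trans this

/-- Once the bottom half is fixed, the top half is a free choice among the half diagrams with `k`
defects. -/
theorem ncard_bottom_eq {n k : ℕ} {h : Half} (hh : IsHalf n k h) :
    {b : Diagram n | b.bottom = h}.ncard = {h | IsHalf n k h}.ncard := by
  have : {h | IsHalf n k h} = (fun b => b.flip.bottom) '' {b : Diagram n | b.bottom = h} := by
    ext h'
    constructor
    · intro hh'
      obtain ⟨a, ha, ha'⟩ := exists_diagram_of_halves hh hh'
      exact ⟨a, ha, ha'⟩
    · rintro ⟨a, rfl, rfl⟩
      exact (isHalf_flip_bottom_iff a).2 ((isHalf_bottom_iff a).1 hh)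
  rw [this, Set.InjOn.ncard_image]
  exact fun a ha b hb e => Diagram.eq_of_halves (ha.trans (Eq.symm hb)) e

theorem ncard_flip_bottom_eq {n k : ℕ} {h : Half} (hh : IsHalf n k h) :
    {b : Diagram n | b.flip.bottom = h}.ncard = {h | IsHalf n k h}.ncard := by
  have : {h | IsHalf n k h} = (fun b => b.bottom) '' {b : Diagram n | b.flip.bottom = h} := by
    ext h'
    constructor
    · intro hh'
      obtain ⟨a, ha, ha'⟩ := exists_diagram_of_halves hh' hh
      exact ⟨a, ha', ha⟩
    · rintro ⟨a, rfl, rfl⟩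
      exact (isHalf_bottom_iff a).2 ((isHalf_flip_bottom_iff a).1 hh)
  rw [this, Set.InjOn.ncard_image]
  exact fun a ha b hb e => Diagram.eq_of_halves e (ha.trans (Eq.symm hb))

theorem ncard_throughStrands_eq (n k : ℕ) :
    {b : Diagram n | b.throughStrands = k}.ncard = {h | IsHalf n k h}.ncard ^ 2 := by
  have : {h | IsHalf n k h} ×ˢ {h | IsHalf n k h} =
      (fun b => (b.bottom, b.flip.bottom)) '' {b : Diagram n | b.throughStrands = k} := by
    ext ⟨h, h'⟩
    constructor
    · rintro ⟨hh, hh'⟩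
      obtain ⟨a, ha, ha'⟩ := exists_diagram_of_halves hh hh'
      exact ⟨a, (isHalf_bottom_iff a).1 (by rwa [ha]), Prod.ext ha ha'⟩
    · rintro ⟨a, ha, e⟩
      cases e
      exact ⟨(isHalf_bottom_iff a).2 ha, (isHalf_flip_bottom_iff a).2 ha⟩
  rw [sq, ← Set.ncard_prod, this, Set.InjOn.ncard_image]
  exact fun a _ b _ e => Diagram.eq_of_halves (congrArg Prod.fst e) (congrArg Prod.snd e)

end Motzkin

/-! ### The main theorem -/

theorem mainTheorem7 (n : ℕ) :
    -- The number of through strands gives an order isomorphism from the J-cells to `{n, …, 0}`.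
    (∃ φ : GreenCell.JCell (Motzkin.Diagram n) ≃o (Fin (n + 1))ᵒᵈ,
      ∀ (J : GreenCell.JCell (Motzkin.Diagram n)) (a : Motzkin.Diagram n), a ∈ J.1 →
        ((OrderDual.ofDual (φ J) : Fin (n + 1)) : ℕ) = a.throughStrands) ∧
    -- Let `J` be the J-cell of diagrams with `k` through strands, and `ℓ` the claimed number.
    ∀ (J : Set (Motzkin.Diagram n)) (k : ℕ) (ℓ : ℚ), GreenCell.IsJCell J →
      (∃ a ∈ J, a.throughStrands = k) →
      ℓ = ∑ t ∈ Finset.range (n + 1), ((k : ℚ) + 1) / ((k : ℚ) + (t : ℚ) + 1) *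
        (n.choose (k + 2 * t) : ℚ) * ((k + 2 * t).choose t : ℚ) →
      -- numbers of left and right cells in `J`
      ({L : Set (Motzkin.Diagram n) | GreenCell.IsLeftCell L ∧ L ⊆ J}.ncard : ℚ) = ℓ ∧
      ({R : Set (Motzkin.Diagram n) | GreenCell.IsRightCell R ∧ R ⊆ J}.ncard : ℚ) = ℓ ∧
      -- sizes of left and right cells in `J`
      (∀ L : Set (Motzkin.Diagram n), GreenCell.IsLeftCell L → L ⊆ J → (L.ncard : ℚ) = ℓ) ∧
      (∀ R : Set (Motzkin.Diagram n), GreenCell.IsRightCell R → R ⊆ J → (R.ncard : ℚ) = ℓ) ∧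
      -- size of `J`
      (J.ncard : ℚ) = ℓ ^ 2 ∧
      -- `J` is idempotent
      (∃ e ∈ J, IsIdempotentElem e) ∧
      -- the H-cells in `J` have one element, and the idempotent ones are trivial groups
      ∀ L R : Set (Motzkin.Diagram n), GreenCell.IsLeftCell L → L ⊆ J →
        GreenCell.IsRightCell R → R ⊆ J →
        (L ∩ R).ncard = 1 ∧
        ∀ e ∈ L ∩ R, IsIdempotentElem e →
          ∃ H : Subsemigroup (Motzkin.Diagram n), (H : Set (Motzkin.Diagram n)) = L ∩ R ∧
            Nonempty (H ≃* Unit) := by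
  refine ⟨⟨Motzkin.jCellOrderIso n, fun J a ha => Motzkin.jCellOrderIso_eq J ha⟩, ?_⟩
  rintro J k ℓ hJ ⟨a, haJ, rfl⟩ hℓ
  obtain ⟨k, hk, rfl⟩ := (Motzkin.isJCell_iff J).1 hJ
  obtain rfl : a.throughStrands = k := haJ
  generalize a.throughStrands = k at *
  have hcount : ({h | Motzkin.IsHalf n k h}.ncard : ℚ) = ℓ := by
    rw [Motzkin.ncard_setOf_isHalf, hℓ, Motzkin.halfCount]
    refine Finset.sum_congr rfl fun t _ => ?_
    rw [Motzkin.ballot]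
    ring
  refine ⟨?_, ?_, ?_, ?_, ?_, ?_, ?_⟩
  · rw [Motzkin.ncard_leftCells, hcount]
  · rw [Motzkin.ncard_rightCells, hcount]
  · intro L hL hLJ
    obtain ⟨h, hh, rfl⟩ := (Motzkin.isLeftCell_subset_iff L).1 ⟨hL, hLJ⟩
    rw [Motzkin.ncard_bottom_eq hh, hcount]
  · intro R hR hRJ
    obtain ⟨h, hh, rfl⟩ := (Motzkin.isRightCell_subset_iff R).1 ⟨hR, hRJ⟩
    rw [Motzkin.ncard_flip_bottom_eq hh, hcount]
  · rw [Motzkin.ncard_throughStrands_eq, Nat.cast_pow, hcount]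
  · exact ⟨Motzkin.proj n k, Motzkin.throughStrands_proj hk, Motzkin.proj_mul_proj le_rfl⟩
  · intro L R hL hLJ hR hRJ
    obtain ⟨h, hh, rfl⟩ := (Motzkin.isLeftCell_subset_iff L).1 ⟨hL, hLJ⟩
    obtain ⟨h', hh', rfl⟩ := (Motzkin.isRightCell_subset_iff R).1 ⟨hR, hRJ⟩
    obtain ⟨b, hb, hb'⟩ := Motzkin.exists_diagram_of_halves hh hh'
    -- A left cell fixes the bottom half and a right cell the top half, which together leave exactly
    -- one diagram.
    have hLR : {b : Motzkin.Diagram n | b.bottom = h} ∩ {b | b.flip.bottom = h'} = {b} := by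
      ext c
      constructor
      · rintro ⟨hc, hc'⟩
        exact Motzkin.Diagram.eq_of_halves (hc.trans hb.symm) (hc'.trans hb'.symm)
      · rintro rfl
        exact ⟨hb, hb'⟩
    rw [hLR]
    refine ⟨Set.ncard_singleton b, ?_⟩
    rintro e rfl he
    let H : Subsemigroup (Motzkin.Diagram n) :=
      { carrier := {e}
        mul_mem' := by
          rintro x y rfl rfl
          exact he }
    let inst : Unique H := Set.uniqueSingleton e
    exact ⟨H, rfl, ⟨MulEquiv.ofUnique⟩⟩
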